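/- **Setting.** Let $a,q:\mathbb R\to\mathbb R$ be bounded and uniformly continuous with $\inf_{\mathbb R}a>0$, and let $f:\mathbb R\times[0,1]\to\mathbb R$ be such that $f(\cdot,s)$ is bounded and uniformly continuous on $\mathbb R$, uniformly in $s\in[0,1]$, and $f(x,\cdot)$ is of class $\mathcal C^{1+\gamma}([0,1])$ uniformly in $x$, for some $\gamma\in(0,1)$. Assume that $f(x,0)=f(x,1)=0$ for all $x$, that $\inf_{x\in\mathbb R}f(x,s)>0$ for every $s\in(0,1)$, that $f(x,s)\le f_s'(x,0)s$ for all $(x,s)\in\mathbb R\times[0,1]$, and that $\liminf_{|x|\to+\infty}\big(4f_s'(x,0)a(x)-q(x)^2\big)>0$. For $p\in\mathbb R$ put $\mathcal L\phi=a\phi''+q\phi'+f_s'(\cdot,0)\phi$ and $L_p\phi=e^{-px}\mathcal L(e^{px}\phi)$. For $R\in\mathbb R$ let $\mathcal A_R$ be the set of $\phi\in\mathcal C^1([R,\infty))\cap\mathcal C^2((R,\infty))$ with $\phi'/\phi\in L^\infty((R,\infty))$, $\phi>0$ on $[R,\infty)$ and $\lim_{x\to+\infty}\frac1x\ln\phi(x)=0$;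 let $\mathcal A_{-\infty}$ be the set of $\phi\in\mathcal C^2(\mathbb R)$ with $\phi'/\phi\in L^\infty(\mathbb R)$, $\phi>0$ on $\mathbb R$ and $\lim_{|x|\to+\infty}\frac1x\ln\phi(x)=0$. For a second-order operator $L$ and $R\in\{-\infty\}\cup\mathbb R$ define $$\underline{\lambda_1}(L,(R,\infty))=\sup\{\lambda\in\mathbb R:\exists\phi\in\mathcal A_R,\ L\phi\ge\lambda\phi\text{ in }(R,\infty)\},$$ $$\overline{\lambda_1}(L,(R,\infty))=\inf\{\lambda\in\mathbb R:\exists\phi\in\mathcal A_R,\ L\phi\le\lambda\phi\text{ in }(R,\infty)\},$$ and set $$\underline H(p)=\lim_{R\to+\infty}\underline{\lambda_1}(L_p,(R,\infty)),\quad \overline H(p)=\lim_{R\to+\infty}\overline{\lambda_1}(L_p,(R,\infty)),$$ $$\underline w=\inf_{p>0}\frac{\underline H(-p)}p,\qquad \overline w=\inf_{p>0}\frac{\overline H(-p)}p.$$ A function $g:\mathbb R\to\mathbb R$ is *almost periodic* if every real sequence $(x_n)$ has a subsequence $(x_{n_k})$ such that $g(x_{n_k}+\cdot)$ converges uniformly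 on $\mathbb R$. **Proposition.** Assume that there exist almost periodic functions $a^*,q^*,c^*:\mathbb R\to\mathbb R$ such that $$\lim_{R\to+\infty}\ \sup_{x\ge R}\big\{|a(x)-a^*(x)|+|q(x)-q^*(x)|+|f_s'(x,0)-c^*(x)|\big\}=0,$$ and let $\mathcal L^*\phi=a^*\phi''+q^*\phi'+c^*\phi$, $L^*_p\phi=e^{-px}\mathcal L^*(e^{px}\phi)$. Then for all $p\in\mathbb R$ the limits defining $\underline H(p)$ and $\overline H(p)$ exist, and $$\underline H(p)=\overline H(p)=\overline{\lambda_1}(L_p^*,\mathbb R)=\underline{\lambda_1}(L_p^*,\mathbb R),$$ a finite real number. Moreover the infima defining $\underline w$ and $\overline w$ are attained, and $$\overline w=\underline w=\min_{p>0}\frac{\overline{\lambda_1}(L^*_{-p},\mathbb R)}{p}=\min_{p>0}\frac{\underline{\lambda_1}(L^*_{-p},\mathbb R)}{p},$$ a finite real number. -/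

import Mathlib

open Set Filter Topology

noncomputable section

namespace MonostableKPP

/-- The derivative `f_s'(x,0)` at `s = 0` of a reaction term `f : ℝ × [0,1] → ℝ`
(only the values of `f x` on `[0,1]` matter, so the derivative is one-sided). -/
def dsZero (f : ℝ → ℝ → ℝ) (x : ℝ) : ℝ := derivWithin (f x) (Icc 0 1) 0

/-- The standing assumptions on the coefficients `a`, `q` and on the monostable KPP
reaction term `f` of the equation `u_t - a(x) u_xx - q(x) u_x = f(x,u)`. -/
structure StandingAssumptions (a q : ℝ → ℝ) (f : ℝ → ℝ → ℝ) : Prop where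
  a_unifCont : UniformContinuous a
  a_bounded : ∃ M : ℝ, ∀ x, |a x| ≤ M
  q_unifCont : UniformContinuous q
  q_bounded : ∃ M : ℝ, ∀ x, |q x| ≤ M
  /-- `f(·,s)` is uniformly continuous, uniformly in `s ∈ [0,1]`. -/
  f_unifCont : ∀ ε > 0, ∃ δ > 0, ∀ s ∈ Icc (0 : ℝ) 1, ∀ x y : ℝ,
    |x - y| < δ → |f x s - f y s| < ε
  f_bounded : ∃ M : ℝ, ∀ x, ∀ s ∈ Icc (0 : ℝ) 1, |f x s| ≤ M
  /-- `f` is of class `C^{1+γ}` in `s ∈ [0,1]`, uniformly in `x`, for some `γ ∈ (0,1)`. -/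
  f_diff : ∀ x, DifferentiableOn ℝ (f x) (Icc 0 1)
  f_holder : ∃ γ ∈ Ioo (0 : ℝ) 1, ∃ C : ℝ, ∀ x, ∀ s ∈ Icc (0 : ℝ) 1, ∀ t ∈ Icc (0 : ℝ) 1,
    |derivWithin (f x) (Icc 0 1) s - derivWithin (f x) (Icc 0 1) t| ≤ C * |s - t| ^ γ
  f_zero : ∀ x, f x 0 = 0
  f_one : ∀ x, f x 1 = 0
  f_pos : ∀ s ∈ Ioo (0 : ℝ) 1, 0 < ⨅ x, f x s
  f_kpp : ∀ x, ∀ s ∈ Icc (0 : ℝ) 1, f x s ≤ dsZero f x * s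
  a_pos : 0 < ⨅ x, a x
  liminf_pos : 0 < liminf (fun x => 4 * dsZero f x * a x - q x ^ 2) (cocompact ℝ)

/-- Almost periodicity in the sense of Bochner: every sequence of translations has a
subsequence along which the translates converge uniformly on `ℝ`. -/
def AlmostPeriodic (g : ℝ → ℝ) : Prop :=
  ∀ y : ℕ → ℝ, ∃ k : ℕ → ℕ, StrictMono k ∧ ∃ h : ℝ → ℝ,
    TendstoUniformly (fun n x => g (y (k n) + x)) h atTop

/-- The operator `𝓛 φ = a φ'' + q φ' + c φ`. -/
def ellOp (a q c : ℝ → ℝ) (φ : ℝ → ℝ) (x : ℝ) : ℝ :=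
  a x * deriv (deriv φ) x + q x * deriv φ x + c x * φ x

/-- The operator `L_p φ = e^{-px} 𝓛 (e^{px} φ)`. -/
def conjOp (a q c : ℝ → ℝ) (p : ℝ) (φ : ℝ → ℝ) (x : ℝ) : ℝ :=
  Real.exp (-(p * x)) * ellOp a q c (fun y => Real.exp (p * y) * φ y) x

/-- The admissible test functions over the half-line `(R,∞)`; values of `φ` to the left
of `R` are irrelevant. -/
def admissibleHalf (R : ℝ) : Set (ℝ → ℝ) :=
  {φ | ContDiffOn ℝ 1 φ (Ici R) ∧ ContDiffOn ℝ 2 φ (Ioi R) ∧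
    (∃ M : ℝ, ∀ x ∈ Ioi R, |deriv φ x / φ x| ≤ M) ∧
    (∀ x ∈ Ici R, 0 < φ x) ∧
    Tendsto (fun x => 1 / x * Real.log (φ x)) atTop (𝓝 0)}

/-- The admissible test functions over `ℝ`. -/
def admissibleLine : Set (ℝ → ℝ) :=
  {φ | ContDiff ℝ 2 φ ∧
    (∃ M : ℝ, ∀ x, |deriv φ x / φ x| ≤ M) ∧
    (∀ x, 0 < φ x) ∧
    Tendsto (fun x => 1 / x * Real.log (φ x)) (cocompact ℝ) (𝓝 0)}

/-- `sup {l | ∃ φ ∈ A, L φ ≥ l φ in I}`, in `[-∞,∞]`. -/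
def lowerEig (A : Set (ℝ → ℝ)) (I : Set ℝ) (L : (ℝ → ℝ) → ℝ → ℝ) : EReal :=
  sSup {m : EReal | ∃ l : ℝ, m = (l : EReal) ∧ ∃ φ ∈ A, ∀ x ∈ I, l * φ x ≤ L φ x}

/-- `inf {l | ∃ φ ∈ A, L φ ≤ l φ in I}`, in `[-∞,∞]`. -/
def upperEig (A : Set (ℝ → ℝ)) (I : Set ℝ) (L : (ℝ → ℝ) → ℝ → ℝ) : EReal :=
  sInf {m : EReal | ∃ l : ℝ, m = (l : EReal) ∧ ∃ φ ∈ A, ∀ x ∈ I, L φ x ≤ l * φ x}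

/-- The lower generalized principal eigenvalue of `L` in `(R,∞)`, `R ∈ ℝ`. -/
def lowerEigHalf (L : (ℝ → ℝ) → ℝ → ℝ) (R : ℝ) : EReal :=
  lowerEig (admissibleHalf R) (Ioi R) L

/-- The upper generalized principal eigenvalue of `L` in `(R,∞)`, `R ∈ ℝ`. -/
def upperEigHalf (L : (ℝ → ℝ) → ℝ → ℝ) (R : ℝ) : EReal :=
  upperEig (admissibleHalf R) (Ioi R) L

/-- The lower generalized principal eigenvalue of `L` in `ℝ`. -/
def lowerEigLine (L : (ℝ → ℝ) → ℝ → ℝ) : EReal := lowerEig admissibleLine univ L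

/-- The upper generalized principal eigenvalue of `L` in `ℝ`. -/
def upperEigLine (L : (ℝ → ℝ) → ℝ → ℝ) : EReal := upperEig admissibleLine univ L

/-- The lower Hamiltonian: the limit as `R → +∞` of the lower eigenvalue of `L_p` in `(R,∞)`.
(The eigenvalue is monotone in `R`, so that the limit exists in `[-∞,∞]`.) -/
def lowerH (a q c : ℝ → ℝ) (p : ℝ) : EReal :=
  limUnder atTop (fun R : ℝ => lowerEigHalf (conjOp a q c p) R)

/-- The upper Hamiltonian: the limit as `R → +∞` of the upper eigenvalue of `L_p` in `(R,∞)`. -/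
def upperH (a q c : ℝ → ℝ) (p : ℝ) : EReal :=
  limUnder atTop (fun R : ℝ => upperEigHalf (conjOp a q c p) R)

/-- The set of values `K(-p)/p`, `p > 0`. -/
def speedValues (K : ℝ → EReal) : Set EReal :=
  (fun p : ℝ => K (-p) / (p : EReal)) '' Ioi 0

/-- The lower speed; that the infimum is a minimum is part of the theorem. -/
def lowerSpeed (a q c : ℝ → ℝ) : EReal := sInf (speedValues (lowerH a q c))

/-- The upper speed; that the infimum is a minimum is part of the theorem. -/
def upperSpeed (a q c : ℝ → ℝ) : EReal := sInf (speedValues (upperH a q c))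

end MonostableKPP

end

open MonostableKPP

namespace MonostableKPP

/-! Writing φ = e^w turns L_p φ / φ into the Riccati expression a(w'' + (w'+p)²) + q(w'+p) + c, so
everything is decided by sub- and supersolutions w of a one-dimensional viscous Hamilton–Jacobi
equation.

Existence. For almost periodic coefficients the discounted equation "Riccati = ε w" is solved with
bounds on εw, w', w'' independent of ε (`exists_corrector`). Comparing translates of the solution
shows that εw(t) and εw(r) are close whenever the coefficients translated by t and by r are close.
Finitely many r suffice for all t, and for these εw(r) - εw(0) → 0 because w' is bounded. Hence εw
is nearly constant, and e^w is an approximate eigenfunction usable in both the sup and the inf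
(`exists_approx_corrector`).

Uniqueness. On a half-line a subsolution level never exceeds a supersolution level
(`HalfProfile.comparison`): otherwise the difference of the logarithmic derivatives is eventually
bounded away from 0 with constant sign, which contradicts the subexponential growth of test
functions. So the approximate eigenvalues converge to one number H(p) (`exists_isEffective`), equal
to both eigenvalues on the line. Since the coefficients of the problem approach the limiting ones at
+∞, the same correctors give both half-line limits (`IsEffective.tendsto_eigHalf`).

Speeds. H is convex because the Riccati expression is convex in (w'+p, w''), hence continuous. It is
bounded below by a positive constant, from the discriminant condition, and grows quadratically, so
H(-p)/p has a minimum on p > 0 (`exists_min_speed`). -/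

/-! ### Bounded solutions of `W'' = k² W - g` -/

/-- The bounded solution of `D' = g - k D`. -/
noncomputable def decayIntegral (k : ℝ) (g : ℝ → ℝ) (x : ℝ) : ℝ :=
  Real.exp (-(k * x)) * ∫ y in Iic x, Real.exp (k * y) * g y

lemma integrableOn_exp_mul_of_bounded {k : ℝ} (hk : 0 < k) {g : ℝ → ℝ} (hg : Continuous g)
    {B : ℝ} (hB : ∀ x, |g x| ≤ B) (x : ℝ) :
    MeasureTheory.IntegrableOn (fun y => Real.exp (k * y) * g y) (Iic x) := by
  refine MeasureTheory.Integrable.mono' ((integrableOn_exp_mul_Iic hk x).mul_const B)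
    (by fun_prop) (Eventually.of_forall fun y => ?_)
  rw [norm_mul, Real.norm_eq_abs, Real.norm_eq_abs, Real.abs_exp]
  exact mul_le_mul_of_nonneg_left (hB y) (Real.exp_pos _).le

lemma hasDerivAt_decayIntegral {k : ℝ} (hk : 0 < k) {g : ℝ → ℝ} (hg : Continuous g)
    {B : ℝ} (hB : ∀ x, |g x| ≤ B) (x : ℝ) :
    HasDerivAt (decayIntegral k g) (g x - k * decayIntegral k g x) x := by
  have hint := integrableOn_exp_mul_of_bounded hk hg hB
  have hc : Continuous fun y => Real.exp (k * y) * g y := by fun_prop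
  have h1 : HasDerivAt (fun x => ∫ y in Iic x, Real.exp (k * y) * g y)
      (Real.exp (k * x) * g x) x := by
    have h := (intervalIntegral.integral_hasDerivAt_right (hc.intervalIntegrable 0 x)
      (hc.stronglyMeasurableAtFilter _ _) hc.continuousAt).const_add
      (∫ y in Iic 0, Real.exp (k * y) * g y)
    refine h.congr_of_eventuallyEq (Eventually.of_forall fun t => ?_)
    simp only [← intervalIntegral.integral_Iic_sub_Iic (hint 0) (hint t)]
    ring
  have h2 : HasDerivAt (fun x : ℝ => Real.exp (-(k * x))) (Real.exp (-(k * x)) * (-k)) x := by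
    have := ((hasDerivAt_id x).const_mul k).neg.exp
    simpa using this
  refine (h2.mul h1).congr_deriv ?_
  have : Real.exp (-(k * x)) * Real.exp (k * x) = 1 := by
    rw [← Real.exp_add]; simp
  unfold decayIntegral
  linear_combination (g x) * this

/-- The kernel e^{-k(x-y)} on y ≤ x has mass 1/k. The form with differences serves the contraction
argument; taking `g' = 0` later gives the plain bounds. -/
lemma abs_decayIntegral_sub_le {k : ℝ} (hk : 0 < k) {g g' : ℝ → ℝ} (hg : Continuous g)
    (hg' : Continuous g') {B B' : ℝ} (hB : ∀ x, |g x| ≤ B) (hB' : ∀ x, |g' x| ≤ B')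
    {δ : ℝ} (hδ : ∀ x, |g x - g' x| ≤ δ) (x : ℝ) :
    |decayIntegral k g x - decayIntegral k g' x| ≤ δ / k := by
  unfold decayIntegral
  rw [← mul_sub, ← MeasureTheory.integral_sub (integrableOn_exp_mul_of_bounded hk hg hB x)
    (integrableOn_exp_mul_of_bounded hk hg' hB' x), abs_mul, Real.abs_exp]
  have h : ‖∫ y in Iic x, (Real.exp (k * y) * g y - Real.exp (k * y) * g' y)‖ ≤
      ∫ y in Iic x, Real.exp (k * y) * δ := by
    refine MeasureTheory.norm_integral_le_of_norm_le
      ((integrableOn_exp_mul_Iic hk x).mul_const δ) (Eventually.of_forall fun y => ?_)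
    rw [← mul_sub, norm_mul, Real.norm_eq_abs, Real.norm_eq_abs, Real.abs_exp]
    exact mul_le_mul_of_nonneg_left (hδ y) (Real.exp_pos _).le
  rw [MeasureTheory.integral_mul_const, integral_exp_mul_Iic hk, Real.norm_eq_abs] at h
  refine (mul_le_mul_of_nonneg_left h (Real.exp_pos _).le).trans_eq ?_
  have : Real.exp (-(k * x)) * Real.exp (k * x) = 1 := by
    rw [← Real.exp_add]; simp
  field_simp
  linear_combination δ * this

/-- The bounded solution of `W'' = k² W - g`. -/
noncomputable def greenSol (k : ℝ) (g : ℝ → ℝ) (x : ℝ) : ℝ :=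
  (decayIntegral k g x + decayIntegral k (fun y => g (-y)) (-x)) / (2 * k)

/-- The derivative of `greenSol`. -/
noncomputable def greenDeriv (k : ℝ) (g : ℝ → ℝ) (x : ℝ) : ℝ :=
  (-decayIntegral k g x + decayIntegral k (fun y => g (-y)) (-x)) / 2

section Green

variable {k : ℝ} {g g' : ℝ → ℝ} {B B' : ℝ}

lemma hasDerivAt_decayIntegral_reflect (hk : 0 < k) (hg : Continuous g) (hB : ∀ x, |g x| ≤ B)
    (x : ℝ) :
    HasDerivAt (fun x => decayIntegral k (fun y => g (-y)) (-x))
      (-(g x - k * decayIntegral k (fun y => g (-y)) (-x))) x := by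
  have h := hasDerivAt_decayIntegral hk (g := fun y => g (-y)) (by fun_prop)
    (fun y => hB (-y)) (-x)
  have := h.comp x (hasDerivAt_neg x)
  simpa [Function.comp_def] using this

lemma hasDerivAt_greenSol (hk : 0 < k) (hg : Continuous g) (hB : ∀ x, |g x| ≤ B) (x : ℝ) :
    HasDerivAt (greenSol k g) (greenDeriv k g x) x := by
  refine (((hasDerivAt_decayIntegral hk hg hB x).add
    (hasDerivAt_decayIntegral_reflect hk hg hB x)).div_const (2 * k)).congr_deriv ?_
  unfold greenDeriv
  field_simp
  ring

lemma hasDerivAt_greenDeriv (hk : 0 < k) (hg : Continuous g) (hB : ∀ x, |g x| ≤ B) (x : ℝ) :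
    HasDerivAt (greenDeriv k g) (k ^ 2 * greenSol k g x - g x) x := by
  refine (((hasDerivAt_decayIntegral hk hg hB x).neg.add
    (hasDerivAt_decayIntegral_reflect hk hg hB x)).div_const 2).congr_deriv ?_
  unfold greenSol
  field_simp
  ring

lemma abs_greenSol_sub_le (hk : 0 < k) (hg : Continuous g) (hg' : Continuous g')
    (hB : ∀ x, |g x| ≤ B) (hB' : ∀ x, |g' x| ≤ B') {δ : ℝ} (hδ : ∀ x, |g x - g' x| ≤ δ)
    (x : ℝ) : |greenSol k g x - greenSol k g' x| ≤ δ / k ^ 2 := by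
  have h1 := abs_decayIntegral_sub_le hk hg hg' hB hB' hδ x
  have h2 := abs_decayIntegral_sub_le hk (g := fun y => g (-y)) (g' := fun y => g' (-y))
    (by fun_prop) (by fun_prop) (fun y => hB _) (fun y => hB' _) (fun y => hδ _) (-x)
  unfold greenSol
  rw [← sub_div, abs_div, abs_of_pos (by positivity : 0 < 2 * k), div_le_iff₀ (by positivity)]
  have : δ / k ^ 2 * (2 * k) = δ / k + δ / k := by field_simp; ring
  rw [this]
  rw [abs_le] at *
  constructor <;> linarith [h1.1, h1.2, h2.1, h2.2]

lemma abs_greenDeriv_sub_le (hk : 0 < k) (hg : Continuous g) (hg' : Continuous g')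
    (hB : ∀ x, |g x| ≤ B) (hB' : ∀ x, |g' x| ≤ B') {δ : ℝ} (hδ : ∀ x, |g x - g' x| ≤ δ)
    (x : ℝ) : |greenDeriv k g x - greenDeriv k g' x| ≤ δ / k := by
  have h1 := abs_decayIntegral_sub_le hk hg hg' hB hB' hδ x
  have h2 := abs_decayIntegral_sub_le hk (g := fun y => g (-y)) (g' := fun y => g' (-y))
    (by fun_prop) (by fun_prop) (fun y => hB _) (fun y => hB' _) (fun y => hδ _) (-x)
  unfold greenDeriv
  rw [abs_le] at *
  constructor <;> linarith [h1.1, h1.2, h2.1, h2.2]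

lemma decayIntegral_zero : decayIntegral k (fun _ => 0) = fun _ => 0 := by
  ext x; simp [decayIntegral]

lemma abs_greenSol_le (hk : 0 < k) (hg : Continuous g) (hB : ∀ x, |g x| ≤ B) (x : ℝ) :
    |greenSol k g x| ≤ B / k ^ 2 := by
  have := abs_greenSol_sub_le hk hg (g' := fun _ => 0) continuous_const hB (B' := 0)
    (by simp) (δ := B) (by simpa using hB) x
  simpa [greenSol, decayIntegral_zero] using this

lemma abs_greenDeriv_le (hk : 0 < k) (hg : Continuous g) (hB : ∀ x, |g x| ≤ B) (x : ℝ) :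
    |greenDeriv k g x| ≤ B / k := by
  have := abs_greenDeriv_sub_le hk hg (g' := fun _ => 0) continuous_const hB (B' := 0)
    (by simp) (δ := B) (by simpa using hB) x
  simpa [greenDeriv, decayIntegral_zero] using this

end Green

/-- A Picard type theorem on the whole line. -/
theorem exists_bounded_solution {Φ : ℝ → ℝ → ℝ → ℝ}
    (hΦ : Continuous fun z : ℝ × ℝ × ℝ => Φ z.1 z.2.1 z.2.2) {B : ℝ}
    (hB : ∀ x, |Φ x 0 0| ≤ B) {k L θ : ℝ} (hk : 0 < k) (hθ : 0 ≤ θ) (hL : 0 ≤ L)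
    (hlip : ∀ x w₁ w₂ v₁ v₂,
      |Φ x w₁ v₁ - Φ x w₂ v₂| ≤ θ * k ^ 2 * |w₁ - w₂| + L * |v₁ - v₂|)
    (hlt : θ + L / k < 1) :
    ∃ w v : ℝ → ℝ, (∀ x, HasDerivAt w (v x) x) ∧
      (∀ x, HasDerivAt v (k ^ 2 * w x - Φ x (w x) (v x)) x) ∧
      (∃ C, ∀ x, |w x| ≤ C) := by
  classical
  have hnorm : ∀ (g : BoundedContinuousFunction ℝ ℝ) x, |g x| ≤ ‖g‖ := fun g x => by
    simpa using g.norm_coe_le_norm x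
  have hW : ∀ g : BoundedContinuousFunction ℝ ℝ, Continuous (greenSol k g) := fun g =>
    continuous_iff_continuousAt.2 fun x =>
      (hasDerivAt_greenSol hk g.continuous (hnorm g) x).continuousAt
  have hV : ∀ g : BoundedContinuousFunction ℝ ℝ, Continuous (greenDeriv k g) := fun g =>
    continuous_iff_continuousAt.2 fun x =>
      (hasDerivAt_greenDeriv hk g.continuous (hnorm g) x).continuousAt
  -- The unknown is the source g = Φ(x, w, w') rather than w, so the sup norm suffices. Solving
  -- gains 1/k² for w and 1/k for w', whence the contraction factor θ + L/k.
  let T : BoundedContinuousFunction ℝ ℝ → BoundedContinuousFunction ℝ ℝ := fun g =>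
    BoundedContinuousFunction.ofNormedAddCommGroup
      (fun x => Φ x (greenSol k g x) (greenDeriv k g x))
      (hΦ.comp (continuous_id.prodMk ((hW g).prodMk (hV g))))
      (θ * k ^ 2 * (‖g‖ / k ^ 2) + L * (‖g‖ / k) + B) (fun x => by
        have h1 := hlip x (greenSol k g x) 0 (greenDeriv k g x) 0
        have h2 := abs_greenSol_le hk g.continuous (hnorm g) x
        have h3 := abs_greenDeriv_le hk g.continuous (hnorm g) x
        have h4 : |Φ x (greenSol k g x) (greenDeriv k g x)| ≤
            |Φ x (greenSol k g x) (greenDeriv k g x) - Φ x 0 0| + |Φ x 0 0| := by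
          have := abs_add_le (Φ x (greenSol k g x) (greenDeriv k g x) - Φ x 0 0) (Φ x 0 0)
          simpa using this
        rw [Real.norm_eq_abs]
        refine h4.trans (add_le_add (h1.trans ?_) (hB x))
        rw [sub_zero, sub_zero]
        gcongr)
  have hT : ContractingWith (Real.toNNReal (θ + L / k)) T := by
    refine ⟨by rw [← NNReal.coe_lt_coe, Real.coe_toNNReal _ (by positivity)]; simpa using hlt,
      LipschitzWith.of_dist_le_mul fun g g' => ?_⟩
    rw [Real.coe_toNNReal _ (by positivity), BoundedContinuousFunction.dist_le (by positivity)]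
    intro x
    have hd : ∀ x, |g x - g' x| ≤ dist g g' := fun x => by
      simpa [Real.dist_eq] using BoundedContinuousFunction.dist_coe_le_dist (f := g) (g := g') x
    have h2 := abs_greenSol_sub_le hk g.continuous g'.continuous (hnorm g) (hnorm g') hd x
    have h3 := abs_greenDeriv_sub_le hk g.continuous g'.continuous (hnorm g) (hnorm g') hd x
    calc dist (T g x) (T g' x) = |Φ x (greenSol k g x) (greenDeriv k g x) -
          Φ x (greenSol k g' x) (greenDeriv k g' x)| := rfl
      _ ≤ _ := hlip _ _ _ _ _
      _ ≤ θ * k ^ 2 * (dist g g' / k ^ 2) + L * (dist g g' / k) := by gcongr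
      _ = _ := by field_simp
  obtain ⟨g, hg⟩ : ∃ g, T g = g := ⟨_, hT.fixedPoint_isFixedPt⟩
  refine ⟨greenSol k g, greenDeriv k g, hasDerivAt_greenSol hk g.continuous (hnorm g),
    fun x => ?_, _, abs_greenSol_le hk g.continuous (hnorm g)⟩
  have h : Φ x (greenSol k g x) (greenDeriv k g x) = g x := congrArg (fun g => g x) hg
  rw [h]
  exact hasDerivAt_greenDeriv hk g.continuous (hnorm g) x

/-! ### The maximum principle on the line -/

/-- If s > 0, the second derivative test makes the maximum point a local minimum too, so f is
locally constant and s = 0. No continuity of the second derivative is used. -/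
lemma second_deriv_nonpos_of_max {f f₁ : ℝ → ℝ} {x₀ s : ℝ} (h₁ : ∀ x, HasDerivAt f (f₁ x) x)
    (h₂ : HasDerivAt f₁ s x₀) (hmax : ∀ x, f x ≤ f x₀) : f₁ x₀ = 0 ∧ s ≤ 0 := by
  have hd : deriv f = f₁ := funext fun x => (h₁ x).deriv
  have hz : f₁ x₀ = 0 :=
    IsLocalMax.hasDerivAt_eq_zero (f := f) (Eventually.of_forall hmax) (h₁ x₀)
  refine ⟨hz, ?_⟩
  by_contra! hs
  have hmin : IsLocalMin f x₀ := isLocalMin_of_deriv_deriv_pos (by rw [hd, h₂.deriv]; exact hs)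
    (by rw [hd, hz]) (h₁ x₀).continuousAt
  have hc : f =ᶠ[𝓝 x₀] fun _ => f x₀ := by
    filter_upwards [hmin] with x hx using le_antisymm (hmax x) hx
  have h3 : f₁ =ᶠ[𝓝 x₀] fun _ => 0 := by
    have := hc.deriv
    rw [hd] at this
    simpa using this
  have := (h₂.congr_of_eventuallyEq h3.symm).unique (hasDerivAt_const x₀ (0 : ℝ))
  linarith

/-- The supremum need not be attained, so d is penalised by η log(1 + x²), which tends to infinity
but has bounded first and second derivatives; then η → 0. Stating the hypothesis with `max (d₂ x) 0`
and `|d₁ x|` lets differences of nonlinear solutions enter without linearised coefficients. -/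
theorem maximum_principle {d d₁ d₂ : ℝ → ℝ} (h₁ : ∀ x, HasDerivAt d (d₁ x) x)
    (h₂ : ∀ x, HasDerivAt d₁ (d₂ x) x) {C : ℝ} (hC : ∀ x, d x ≤ C) {A L ε E : ℝ}
    (hA : 0 ≤ A) (hL : 0 ≤ L) (hε : 0 < ε)
    (h : ∀ x, ε * d x ≤ A * max (d₂ x) 0 + L * |d₁ x| + E) (y : ℝ) : ε * d y ≤ E := by
  have key : ∀ η : ℝ, 0 < η →
      ε * d y ≤ E + η * (2 * A + L + ε * Real.log (1 + y ^ 2)) := by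
    intro η hη
    set g : ℝ → ℝ := fun x => d x - η * Real.log (1 + x ^ 2) with hg
    have hpos : ∀ x : ℝ, 0 < 1 + x ^ 2 := fun x => by positivity
    have hl : ∀ x, HasDerivAt (fun x : ℝ => Real.log (1 + x ^ 2)) (2 * x / (1 + x ^ 2)) x := by
      intro x
      have := ((hasDerivAt_pow 2 x).const_add 1).log (hpos x).ne'
      simpa using this
    have hl2 : ∀ x, HasDerivAt (fun x : ℝ => 2 * x / (1 + x ^ 2))
        ((2 * (1 + x ^ 2) - 2 * x * (2 * x)) / (1 + x ^ 2) ^ 2) x := by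
      intro x
      exact (((hasDerivAt_id x).const_mul 2).div ((hasDerivAt_pow 2 x).const_add 1)
        (hpos x).ne').congr_deriv (by simp)
    have g1 : ∀ x, HasDerivAt g (d₁ x - η * (2 * x / (1 + x ^ 2))) x := fun x =>
      (h₁ x).sub ((hl x).const_mul η)
    have g2 : ∀ x, HasDerivAt (fun x => d₁ x - η * (2 * x / (1 + x ^ 2)))
        (d₂ x - η * ((2 * (1 + x ^ 2) - 2 * x * (2 * x)) / (1 + x ^ 2) ^ 2)) x := fun x =>
      (h₂ x).sub ((hl2 x).const_mul η)
    have gc : Continuous g := continuous_iff_continuousAt.2 fun x => (g1 x).continuousAt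
    have hlim : Tendsto g (cocompact ℝ) atBot := by
      have hsq : Tendsto (fun x : ℝ => x ^ 2) (cocompact ℝ) atTop := by
        have := (tendsto_pow_atTop (α := ℝ) two_ne_zero).comp (tendsto_norm_cocompact_atTop (E := ℝ))
        simpa [Function.comp_def] using this
      have h3 : Tendsto (fun x : ℝ => C - η * Real.log (1 + x ^ 2)) (cocompact ℝ) atBot := by
        simp only [sub_eq_add_neg]
        refine tendsto_atBot_add_const_left _ _ (tendsto_neg_atTop_atBot.comp ?_)
        exact (Real.tendsto_log_atTop.comp (tendsto_atTop_add_const_left _ 1 hsq)).const_mul_atTop hη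
      exact tendsto_atBot_mono (fun x => sub_le_sub_right (hC x) _) h3
    obtain ⟨x₀, hx₀⟩ := gc.exists_forall_ge hlim
    obtain ⟨e1, e2⟩ := second_deriv_nonpos_of_max g1 (g2 x₀) hx₀
    have b1 : |2 * x₀ / (1 + x₀ ^ 2)| ≤ 1 := by
      rw [abs_div, abs_of_pos (hpos x₀), div_le_one (hpos x₀), abs_le]
      constructor <;> nlinarith [sq_nonneg (x₀ + 1), sq_nonneg (x₀ - 1)]
    have b2 : (2 * (1 + x₀ ^ 2) - 2 * x₀ * (2 * x₀)) / (1 + x₀ ^ 2) ^ 2 ≤ 2 := by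
      rw [div_le_iff₀ (by positivity)]
      nlinarith [sq_nonneg x₀, sq_nonneg (x₀ ^ 2)]
    have c1 : |d₁ x₀| ≤ η := by
      rw [show d₁ x₀ = η * (2 * x₀ / (1 + x₀ ^ 2)) by linarith, abs_mul, abs_of_pos hη]
      exact mul_le_of_le_one_right hη.le b1
    have c2 : max (d₂ x₀) 0 ≤ 2 * η := max_le (by nlinarith) (by linarith)
    have c3 := h x₀
    have c4 : ε * g y ≤ ε * g x₀ := mul_le_mul_of_nonneg_left (hx₀ y) hε.le
    have c5 : 0 ≤ η * Real.log (1 + x₀ ^ 2) :=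
      mul_nonneg hη.le (Real.log_nonneg (by nlinarith [sq_nonneg x₀]))
    have c6 := mul_le_mul_of_nonneg_left c2 hA
    have c7 := mul_le_mul_of_nonneg_left c1 hL
    have c8 := mul_nonneg hε.le c5
    simp only [hg] at c4
    nlinarith
  have hlim : Tendsto (fun η : ℝ => E + η * (2 * A + L + ε * Real.log (1 + y ^ 2))) (𝓝[>] 0)
      (𝓝 (E + 0 * (2 * A + L + ε * Real.log (1 + y ^ 2)))) :=
    (Continuous.tendsto (by fun_prop) 0).mono_left nhdsWithin_le_nhds
  rw [zero_mul, add_zero] at hlim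
  exact ge_of_tendsto hlim (by filter_upwards [self_mem_nhdsWithin] with η hη using key η hη)

/-! ### The discounted equation -/

section Resolvent

variable {a : ℝ → ℝ} {F : ℝ → ℝ → ℝ} {a₀ A L B : ℝ}

/-- With discount a₀k², dividing by a gives w'' = k²w - Φ, where Φ has Lipschitz constant at most (1
- a₀/A)k² in w and L/a₀ in w'. For k large this is within reach of the contraction. -/
lemma exists_resolvent_of_large (ha : Continuous a) (ha₀ : 0 < a₀) (hal : ∀ x, a₀ ≤ a x)
    (hau : ∀ x, a x ≤ A) (hF : Continuous fun z : ℝ × ℝ => F z.1 z.2) (hB : ∀ x, |F x 0| ≤ B)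
    (hL : 0 ≤ L) (hlip : ∀ x v v', |F x v - F x v'| ≤ L * |v - v'|) (ε : ℝ) (hε : 0 < ε) :
    ∃ ε₀ > ε, ∀ f : BoundedContinuousFunction ℝ ℝ, ∃ w v z : ℝ → ℝ,
      (∀ x, HasDerivAt w (v x) x) ∧ (∀ x, HasDerivAt v (z x) x) ∧ (∃ C, ∀ x, |w x| ≤ C) ∧
      ∀ x, a x * z x + F x (v x) + f x = ε₀ * w x := by
  have hA : 0 < A := ha₀.trans_le ((hal 0).trans (hau 0))
  have ha₀A : a₀ ≤ A := (hal 0).trans (hau 0)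
  -- The first two conditions give ε < a₀k²; the third makes the contraction factor (1 - a₀/A) +
  -- L/(a₀k) less than 1.
  obtain ⟨k, hk1, hk2, hk3⟩ : ∃ k : ℝ, 1 ≤ k ∧ ε / a₀ < k ∧ L / a₀ / (a₀ / A) < k := by
    refine ⟨1 + ε / a₀ + L / a₀ / (a₀ / A), ?_, ?_, ?_⟩
    · have : 0 ≤ ε / a₀ := by positivity
      have : 0 ≤ L / a₀ / (a₀ / A) := by positivity
      linarith
    · have : 0 ≤ L / a₀ / (a₀ / A) := by positivity
      linarith
    · have : 0 ≤ ε / a₀ := by positivity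
      linarith
  have hk : 0 < k := by linarith
  have hlt : (1 - a₀ / A) + (L / a₀) / k < 1 := by
    rw [div_lt_iff₀ (by positivity)] at hk3
    have : L / a₀ / k < a₀ / A := by rw [div_lt_iff₀ hk]; linarith
    linarith
  refine ⟨a₀ * k ^ 2, ?_, fun f => ?_⟩
  · rw [div_lt_iff₀ ha₀] at hk2
    nlinarith
  have hapos : ∀ x, 0 < a x := fun x => ha₀.trans_le (hal x)
  have hne : ∀ x, a x ≠ 0 := fun x => (hapos x).ne'
  let Φ : ℝ → ℝ → ℝ → ℝ := fun x w v =>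
    k ^ 2 * (1 - a₀ / a x) * w + (F x v + f x) / a x
  obtain ⟨w, v, h1, h2, h3⟩ := exists_bounded_solution (Φ := Φ) (k := k) (L := L / a₀)
    (θ := 1 - a₀ / A) (B := (B + ‖f‖) / a₀) (by
      have hFc : Continuous fun z : ℝ × ℝ × ℝ => F z.1 z.2.2 :=
        hF.comp (continuous_fst.prodMk (continuous_snd.comp continuous_snd))
      have hac : Continuous fun z : ℝ × ℝ × ℝ => a z.1 := ha.comp continuous_fst
      have hfc : Continuous fun z : ℝ × ℝ × ℝ => f z.1 := f.continuous.comp continuous_fst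
      have hw : Continuous fun z : ℝ × ℝ × ℝ => z.2.1 := continuous_fst.comp continuous_snd
      exact ((continuous_const.mul (continuous_const.sub
        (continuous_const.div hac fun z => hne _))).mul hw).add
        ((hFc.add hfc).div hac fun z => hne _))
    (fun x => by
      have hf : |f x| ≤ ‖f‖ := by simpa using f.norm_coe_le_norm x
      simp only [Φ, mul_zero, zero_add, abs_div, abs_of_pos (hapos x)]
      have h1 : |F x 0 + f x| ≤ B + ‖f‖ := (abs_add_le _ _).trans (add_le_add (hB x) hf)
      have h2 : 0 ≤ B + ‖f‖ := (abs_nonneg _).trans h1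
      exact div_le_div₀ h2 h1 ha₀ (hal x))
    hk (by rw [sub_nonneg, div_le_one hA]; exact ha₀A) (by positivity)
    (fun x w₁ w₂ v₁ v₂ => by
      have e : Φ x w₁ v₁ - Φ x w₂ v₂ =
          k ^ 2 * (1 - a₀ / a x) * (w₁ - w₂) + (F x v₁ - F x v₂) / a x := by
        simp only [Φ]; ring
      rw [e]
      refine (abs_add_le _ _).trans (add_le_add ?_ ?_)
      · have h4 : 0 ≤ 1 - a₀ / a x := by
          rw [sub_nonneg, div_le_one (hapos x)]; exact hal x
        rw [abs_mul, abs_of_nonneg (by positivity), mul_comm (k ^ 2)]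
        have : a₀ / A ≤ a₀ / a x := div_le_div_of_nonneg_left ha₀.le (hapos x) (hau x)
        gcongr
      · rw [abs_div, abs_of_pos (hapos x), div_mul_eq_mul_div]
        exact div_le_div₀ (by positivity) (hlip _ _ _) ha₀ (hal x))
    hlt
  refine ⟨w, v, _, h1, h2, h3, fun x => ?_⟩
  simp only [Φ]
  field_simp [hne x]
  ring

/-- The maximum principle applied to w - w' and to w' - w. It is the resolvent estimate behind both
the next contraction and the a priori bound on εw. -/
lemma resolvent_comparison (hal : ∀ x, 0 ≤ a x) (hau : ∀ x, a x ≤ A) (hL : 0 ≤ L)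
    (hlip : ∀ x v v', |F x v - F x v'| ≤ L * |v - v'|) {ε : ℝ} (hε : 0 < ε)
    {w v z w' v' z' f f' : ℝ → ℝ}
    (h₁ : ∀ x, HasDerivAt w (v x) x) (h₂ : ∀ x, HasDerivAt v (z x) x) {C C' E : ℝ}
    (hC : ∀ x, |w x| ≤ C) (h₁' : ∀ x, HasDerivAt w' (v' x) x) (h₂' : ∀ x, HasDerivAt v' (z' x) x)
    (hC' : ∀ x, |w' x| ≤ C') (heq : ∀ x, a x * z x + F x (v x) + f x = ε * w x)
    (heq' : ∀ x, a x * z' x + F x (v' x) + f' x = ε * w' x) (hE : ∀ x, |f x - f' x| ≤ E)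
    (x : ℝ) : ε * |w x - w' x| ≤ E := by
  have hA : 0 ≤ A := (hal 0).trans (hau 0)
  have aux : ∀ x s, a x * s ≤ A * max s 0 := fun x s =>
    (mul_le_mul_of_nonneg_left (le_max_left s 0) (hal x)).trans
      (mul_le_mul_of_nonneg_right (hau x) (le_max_right s 0))
  have m1 := maximum_principle (fun x => (h₁ x).sub (h₁' x)) (fun x => (h₂ x).sub (h₂' x))
    (C := C + C') (fun x => by
      have := abs_le.1 (hC x); have := abs_le.1 (hC' x)
      change w x - w' x ≤ _
      linarith) hA hL hε (E := E)
    (fun x => by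
      have := abs_le.1 (hlip x (v x) (v' x)); have := abs_le.1 (hE x)
      have := aux x (z x - z' x); have := heq x; have := heq' x
      simp only [Pi.sub_apply]
      linarith) x
  have m2 := maximum_principle (fun x => (h₁' x).sub (h₁ x)) (fun x => (h₂' x).sub (h₂ x))
    (C := C + C') (fun x => by
      have := abs_le.1 (hC x); have := abs_le.1 (hC' x)
      change w' x - w x ≤ _
      linarith) hA hL hε (E := E)
    (fun x => by
      have := abs_le.1 (hlip x (v' x) (v x)); have := abs_le.1 (hE x)
      have := aux x (z' x - z x); have := heq x; have := heq' x
      simp only [Pi.sub_apply]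
      linarith) x
  simp only [Pi.sub_apply] at m1 m2
  rcases abs_cases (w x - w' x) with h | h <;> rw [h.1] <;> linarith

/-- One step brings the discount from ε₀ down to ε: a fixed point of u ↦ (solution for ε₀ with
source (ε₀ - ε)u) solves the equation with discount ε, and the comparison estimate makes this map
Lipschitz with constant (ε₀ - ε)/ε₀ < 1. -/
theorem exists_discounted_solution (ha : Continuous a) (ha₀ : 0 < a₀) (hal : ∀ x, a₀ ≤ a x)
    (hau : ∀ x, a x ≤ A) (hF : Continuous fun z : ℝ × ℝ => F z.1 z.2) (hB : ∀ x, |F x 0| ≤ B)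
    (hL : 0 ≤ L) (hlip : ∀ x v v', |F x v - F x v'| ≤ L * |v - v'|) (ε : ℝ) (hε : 0 < ε) :
    ∃ w v z : ℝ → ℝ,
      (∀ x, HasDerivAt w (v x) x) ∧ (∀ x, HasDerivAt v (z x) x) ∧ (∃ C, ∀ x, |w x| ≤ C) ∧
      ∀ x, a x * z x + F x (v x) = ε * w x := by
  obtain ⟨ε₀, hε₀, hres⟩ := exists_resolvent_of_large ha ha₀ hal hau hF hB hL hlip ε hε
  have hε₀' : 0 < ε₀ := hε.trans hε₀
  choose w v z h1 h2 h3 h4 using fun u : BoundedContinuousFunction ℝ ℝ => hres ((ε₀ - ε) • u)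
  choose C hC using h3
  let T : BoundedContinuousFunction ℝ ℝ → BoundedContinuousFunction ℝ ℝ := fun u =>
    BoundedContinuousFunction.ofNormedAddCommGroup (w u)
      (continuous_iff_continuousAt.2 fun x => (h1 u x).continuousAt) (C u) (hC u)
  have hc0 : 0 ≤ (ε₀ - ε) / ε₀ := div_nonneg (by linarith) hε₀'.le
  have hT : ContractingWith (Real.toNNReal ((ε₀ - ε) / ε₀)) T := by
    refine ⟨?_, LipschitzWith.of_dist_le_mul fun u u' => ?_⟩
    · rw [← NNReal.coe_lt_coe, Real.coe_toNNReal _ hc0, NNReal.coe_one, div_lt_one hε₀']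
      linarith
    rw [Real.coe_toNNReal _ hc0, BoundedContinuousFunction.dist_le (by positivity)]
    intro x
    have := resolvent_comparison (fun x => ha₀.le.trans (hal x)) hau hL hlip hε₀' (h1 u) (h2 u)
      (hC u) (h1 u') (h2 u') (hC u') (h4 u) (h4 u') (E := (ε₀ - ε) * dist u u') (fun x => by
        have hd : |u x - u' x| ≤ dist u u' := by
          simpa [Real.dist_eq] using BoundedContinuousFunction.dist_coe_le_dist (f := u) (g := u') x
        have e : ((ε₀ - ε) • u) x - ((ε₀ - ε) • u') x = (ε₀ - ε) * (u x - u' x) := by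
          simp [mul_sub]
        have hp : 0 < ε₀ - ε := by linarith
        rw [e, abs_mul, abs_of_pos hp]
        gcongr) x
    change |w u x - w u' x| ≤ _
    rw [div_mul_eq_mul_div, le_div_iff₀ hε₀']
    linarith
  obtain ⟨u, hu⟩ : ∃ u, T u = u := ⟨_, hT.fixedPoint_isFixedPt⟩
  refine ⟨w u, v u, z u, h1 u, h2 u, ⟨C u, hC u⟩, fun x => ?_⟩
  have h5 : w u x = u x := congrArg (fun u => u x) hu
  have h6 := h4 u x
  simp only [BoundedContinuousFunction.coe_smul, smul_eq_mul, ← h5] at h6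
  linarith

end Resolvent

/-! ### Discounted correctors -/

/-- Continuous bounded coefficients, uniformly elliptic. -/
structure EllipticCoeff (a q c : ℝ → ℝ) (a₀ A Q C : ℝ) : Prop where
  a_cont : Continuous a
  q_cont : Continuous q
  c_cont : Continuous c
  pos : 0 < a₀
  le_a : ∀ x, a₀ ≤ a x
  a_le : ∀ x, a x ≤ A
  abs_q_le : ∀ x, |q x| ≤ Q
  abs_c_le : ∀ x, |c x| ≤ C

/-- `e^{-w} L_p e^w` in terms of `v = w'` and `z = w''`. -/
def riccati (a q c : ℝ → ℝ) (p : ℝ) (v z : ℝ → ℝ) (x : ℝ) : ℝ :=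
  a x * (z x + (v x + p) ^ 2) + q x * (v x + p) + c x

/-- A bounded `C²` function `w` with bounded derivatives `v = w'` and `z = w''`. -/
structure BoundedProfile (w v z : ℝ → ℝ) : Prop where
  deriv_w : ∀ x, HasDerivAt w (v x) x
  deriv_v : ∀ x, HasDerivAt v (z x) x
  cont_z : Continuous z
  bdd_w : ∃ C, ∀ x, |w x| ≤ C
  bdd_v : ∃ C, ∀ x, |v x| ≤ C
  bdd_z : ∃ C, ∀ x, |z x| ≤ C

/-- A solution of the discounted equation with quantitative bounds. -/
structure IsCorrector (a q c : ℝ → ℝ) (p ε K M Z : ℝ) (w v z : ℝ → ℝ) : Prop where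
  deriv_w : ∀ x, HasDerivAt w (v x) x
  deriv_v : ∀ x, HasDerivAt v (z x) x
  abs_w : ∀ x, ε * |w x| ≤ K
  abs_v : ∀ x, |v x + p| ≤ M
  abs_z : ∀ x, |z x| ≤ Z
  eq : ∀ x, riccati a q c p v z x = ε * w x

/-- The square, with linear growth outside `[-M, M]`. -/
def truncSq (M u : ℝ) : ℝ := |u| * min |u| M

lemma continuous_truncSq (M : ℝ) : Continuous (truncSq M) := by
  unfold truncSq; fun_prop

lemma truncSq_of_abs_le {M u : ℝ} (h : |u| ≤ M) : truncSq M u = u ^ 2 := by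
  rw [truncSq, min_eq_left h, ← sq, sq_abs]

lemma truncSq_of_le_abs {M u : ℝ} (h : M ≤ |u|) : truncSq M u = M * |u| := by
  rw [truncSq, min_eq_right h, mul_comm]

lemma abs_truncSq_sub_le {M : ℝ} (hM : 0 ≤ M) (u v : ℝ) :
    |truncSq M u - truncSq M v| ≤ 2 * M * |u - v| := by
  have key : ∀ s t : ℝ, 0 ≤ s → s ≤ t →
      0 ≤ t * min t M - s * min s M ∧ t * min t M - s * min s M ≤ 2 * M * (t - s) := by
    intro s t hs hst
    rcases le_total t M with h | h
    · rw [min_eq_left h, min_eq_left (hst.trans h)]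
      constructor <;> nlinarith
    · rcases le_total s M with h' | h'
      · rw [min_eq_right h, min_eq_left h']
        constructor <;> nlinarith
      · rw [min_eq_right h, min_eq_right h']
        constructor <;> nlinarith
  have h3 : |(|u| - |v|)| ≤ |u - v| := abs_abs_sub_abs_le_abs_sub u v
  refine le_trans ?_ (mul_le_mul_of_nonneg_left h3 (by positivity))
  unfold truncSq
  rcases le_total |u| |v| with h | h
  · obtain ⟨k1, k2⟩ := key _ _ (abs_nonneg u) h
    rw [abs_sub_comm, abs_of_nonneg k1, abs_sub_comm, abs_of_nonneg (sub_nonneg.2 h)]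
    exact k2
  · obtain ⟨k1, k2⟩ := key _ _ (abs_nonneg v) h
    rw [abs_of_nonneg k1, abs_of_nonneg (sub_nonneg.2 h)]
    exact k2

lemma mul_sub_le_of_le_hasDerivAt {f f' : ℝ → ℝ} {D : Set ℝ} (hD : Convex ℝ D)
    (hf : ∀ x ∈ D, HasDerivAt f (f' x) x) {s : ℝ} (hs : ∀ x ∈ D, s ≤ f' x) {x y : ℝ}
    (hx : x ∈ D) (hy : y ∈ D) (hxy : x ≤ y) : s * (y - x) ≤ f y - f x :=
  hD.mul_sub_le_image_sub_of_le_deriv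
    (fun x hx => (hf x hx).continuousAt.continuousWithinAt)
    (fun x hx => (hf x (interior_subset hx)).differentiableAt.differentiableWithinAt)
    (fun x hx => by rw [(hf x (interior_subset hx)).deriv]; exact hs x (interior_subset hx))
    x hx y hy hxy

/-- Outside the band |v + p| < M the function v decreases strictly. So once v is below the band it
stays below to the right, and if it is above the band it was at least as high to the left. Since |p|
≤ M, either case keeps v away from 0 on a half-line, which a bounded w forbids. -/
lemma abs_deriv_add_le_of_deriv_neg {w v z : ℝ → ℝ} (h₁ : ∀ x, HasDerivAt w (v x) x)
    (h₂ : ∀ x, HasDerivAt v (z x) x) {C : ℝ} (hC : ∀ x, |w x| ≤ C) {M p : ℝ} (hp : |p| ≤ M)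
    (hz : ∀ x, M ≤ |v x + p| → z x < 0) (x : ℝ) : |v x + p| ≤ M := by
  have hp' := abs_le.1 hp
  have barrier : ∀ m x₁ x₂, x₁ ≤ x₂ → v x₁ ≤ m → M ≤ |m + p| → v x₂ ≤ m := by
    intro m x₁ x₂ h12 hm1 hm2
    refine image_le_of_deriv_right_lt_deriv_boundary' (f := v) (f' := z) (a := x₁) (b := x₂)
      (B := fun _ => m) (B' := fun _ => 0)
      (fun x _ => (h₂ x).continuousAt.continuousWithinAt) (fun x _ => (h₂ x).hasDerivWithinAt)
      hm1 continuousOn_const (fun x _ => hasDerivWithinAt_const _ _ _)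
      (fun x _ hx => hz x (by rw [hx]; exact hm2)) ⟨h12, le_rfl⟩
  have hCC : ∀ x y, w y - w x ≤ 2 * C := fun x y => by
    have := abs_le.1 (hC x); have := abs_le.1 (hC y); linarith
  rw [abs_le]
  constructor
  · by_contra! hlt
    have h3 : ∀ y ∈ Ici x, v y ≤ v x := fun y hy => barrier _ x y hy le_rfl (by
      rw [abs_of_neg (by linarith)]; linarith)
    have hneg : v x < 0 := by linarith
    have hC0 : 0 ≤ C := (abs_nonneg _).trans (hC 0)
    -- Over this length w changes by at least 2C + 1, more than |w| ≤ C allows.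
    have h5 : 0 ≤ (2 * C + 1) / (-v x) := div_nonneg (by linarith) (by linarith)
    have h4 := mul_sub_le_of_le_hasDerivAt (f := fun y => -w y) (f' := fun y => -v y)
      (convex_Ici x) (fun y _ => (h₁ y).neg) (s := -v x) (fun y hy => neg_le_neg (h3 y hy))
      (x := x) (y := x + (2 * C + 1) / (-v x)) self_mem_Ici (by simp only [mem_Ici]; linarith)
      (by linarith)
    have e : -v x * (x + (2 * C + 1) / (-v x) - x) = 2 * C + 1 := by
      have : v x ≠ 0 := hneg.ne
      field_simp
      ring
    have := hCC (x + (2 * C + 1) / (-v x)) x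
    linarith
  · by_contra! hlt
    have hpos : 0 < v x := by linarith
    have h3 : ∀ y ∈ Iic x, v x ≤ v y := by
      intro y hy
      by_contra! hlt2
      have hm1 : max (M - p) (v y) < v x := max_lt (by linarith) hlt2
      obtain ⟨m, hm, hm'⟩ := exists_between hm1
      have := barrier m y x hy ((le_max_right _ _).trans hm.le) (by
        have := (le_max_left (M - p) (v y)).trans hm.le
        exact le_trans (by linarith) (le_abs_self _))
      linarith
    have hC0 : 0 ≤ C := (abs_nonneg _).trans (hC 0)
    have h5 : 0 ≤ (2 * C + 1) / v x := div_nonneg (by linarith) (by linarith)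
    have h4 := mul_sub_le_of_le_hasDerivAt (f := w) (f' := v)
      (convex_Iic x) (fun y _ => h₁ y) h3
      (x := x - (2 * C + 1) / v x) (y := x) (by simp only [mem_Iic]; linarith) self_mem_Iic
      (by linarith)
    have e : v x * (x - (x - (2 * C + 1) / v x)) = 2 * C + 1 := by
      have : v x ≠ 0 := hpos.ne'
      field_simp
      ring
    have := hCC (x - (2 * C + 1) / v x) x
    linarith

/-- The square is truncated to make the nonlinearity globally Lipschitz; the gradient bound then
shows that the truncation is inactive on the solution. What matters is that K, M and Z are chosen
before ε. -/
theorem exists_corrector {a q c : ℝ → ℝ} {a₀ A Q C : ℝ} (h : EllipticCoeff a q c a₀ A Q C)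
    (p : ℝ) : ∃ K M Z : ℝ, ∀ ε > 0, ∃ w v z : ℝ → ℝ, IsCorrector a q c p ε K M Z w v z := by
  have hA : 0 < A := h.pos.trans_le ((h.le_a 0).trans (h.a_le 0))
  have hQ : 0 ≤ Q := (abs_nonneg _).trans (h.abs_q_le 0)
  have hC : 0 ≤ C := (abs_nonneg _).trans (h.abs_c_le 0)
  have ha0 := h.pos
  have hapos : ∀ x, 0 < a x := fun x => h.pos.trans_le (h.le_a x)
  set K := A * p ^ 2 + Q * |p| + C with hK
  have hK0 : 0 ≤ K := by positivity
  -- Large enough that for |v + p| ≥ M the truncated square M|v + p| dominates all other terms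
  -- divided by a₀, forcing z < 0.
  set M := 1 + |p| + (K + C + Q) / a₀ with hM
  have hdiv : 0 ≤ (K + C + Q) / a₀ := by positivity
  have hM1 : 1 ≤ M := by have := abs_nonneg p; linarith
  have hMp : |p| ≤ M := by linarith
  refine ⟨K, M, (K + C + Q * M) / a₀ + M ^ 2, fun ε hε => ?_⟩
  let F : ℝ → ℝ → ℝ := fun x v => a x * truncSq M (v + p) + q x * (v + p) + c x
  have hF0 : ∀ x, |F x 0| ≤ K := by
    intro x
    simp only [F, zero_add, truncSq_of_abs_le hMp]
    refine (abs_add_le _ _).trans (add_le_add ((abs_add_le _ _).trans (add_le_add ?_ ?_))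
      (h.abs_c_le x))
    · rw [abs_of_nonneg (mul_nonneg (hapos x).le (sq_nonneg _))]
      exact mul_le_mul_of_nonneg_right (h.a_le x) (sq_nonneg _)
    · rw [abs_mul]
      exact mul_le_mul_of_nonneg_right (h.abs_q_le x) (abs_nonneg _)
  have hlip : ∀ x v v', |F x v - F x v'| ≤ (A * (2 * M) + Q) * |v - v'| := by
    intro x v v'
    have e : F x v - F x v' =
        a x * (truncSq M (v + p) - truncSq M (v' + p)) + q x * (v - v') := by
      simp only [F]; ring
    have h1 := abs_truncSq_sub_le (by linarith : 0 ≤ M) (v + p) (v' + p)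
    rw [add_sub_add_right_eq_sub] at h1
    rw [e, add_mul]
    refine (abs_add_le _ _).trans (add_le_add ?_ ?_)
    · rw [abs_mul, abs_of_pos (hapos x), mul_assoc A]
      exact mul_le_mul (h.a_le x) h1 (abs_nonneg _) hA.le
    · rw [abs_mul]
      exact mul_le_mul_of_nonneg_right (h.abs_q_le x) (abs_nonneg _)
  have hFc : Continuous fun z : ℝ × ℝ => F z.1 z.2 := by
    have := h.a_cont
    have := h.q_cont
    have := h.c_cont
    have := continuous_truncSq M
    simp only [F]
    fun_prop
  have hL : 0 ≤ A * (2 * M) + Q := by positivity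
  obtain ⟨w, v, z, h1, h2, ⟨Cw, hCw⟩, h4⟩ :=
    exists_discounted_solution h.a_cont h.pos h.le_a h.a_le hFc hF0 hL hlip ε hε
  have hw : ∀ x, ε * |w x| ≤ K := by
    intro x
    -- Zero solves the equation with source -F(x, 0), which is bounded by K.
    have := resolvent_comparison (w' := fun _ => 0) (v' := fun _ => 0) (z' := fun _ => 0)
      (f := fun _ => 0) (f' := fun x => -F x 0) (E := K) (C' := 0)
      (fun x => (hapos x).le) h.a_le hL hlip hε h1 h2 hCw (fun x => hasDerivAt_const _ _)
      (fun x => hasDerivAt_const _ _) (by simp) (by simpa using h4) (by simp)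
      (by simpa using hF0) x
    simpa using this
  have hz : ∀ x, |a x * z x + a x * truncSq M (v x + p)| ≤ K + C + Q * |v x + p| := by
    intro x
    have e : a x * z x + a x * truncSq M (v x + p) =
        ε * w x - c x - q x * (v x + p) := by
      have := h4 x
      simp only [F] at this
      linarith
    have k1 : |ε * w x| ≤ K := by rw [abs_mul, abs_of_pos hε]; exact hw x
    have k3 : |q x * (v x + p)| ≤ Q * |v x + p| := by
      rw [abs_mul]
      exact mul_le_mul_of_nonneg_right (h.abs_q_le x) (abs_nonneg _)
    rw [e]
    exact (abs_sub _ _).trans (add_le_add ((abs_sub _ _).trans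
      (add_le_add k1 (h.abs_c_le x))) k3)
  have hz' : ∀ x, |z x + truncSq M (v x + p)| ≤ (K + C + Q * |v x + p|) / a₀ := by
    intro x
    have k1 := hz x
    rw [← mul_add, abs_mul, abs_of_pos (hapos x)] at k1
    rw [le_div_iff₀ h.pos, mul_comm]
    exact (mul_le_mul_of_nonneg_right (h.le_a x) (abs_nonneg _)).trans k1
  have hv : ∀ x, |v x + p| ≤ M := by
    refine abs_deriv_add_le_of_deriv_neg h1 h2 hCw hMp fun x hx => ?_
    have k1 := (abs_le.1 (hz' x)).2
    rw [truncSq_of_le_abs hx] at k1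
    have k2 : 1 ≤ |v x + p| := hM1.trans hx
    have k3 : (K + C + Q * |v x + p|) / a₀ ≤ (K + C + Q) / a₀ * |v x + p| := by
      rw [div_mul_eq_mul_div]
      refine div_le_div_of_nonneg_right ?_ h.pos.le
      nlinarith
    have k4 : 0 ≤ |p| * |v x + p| := by positivity
    rw [hM] at k1
    nlinarith
  refine ⟨w, v, z, h1, h2, hw, hv, fun x => ?_, fun x => ?_⟩
  · have k1 := hz' x
    rw [truncSq_of_abs_le (hv x)] at k1
    have k2 : |z x| ≤ |z x + (v x + p) ^ 2| + |(v x + p) ^ 2| := by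
      have := abs_sub (z x + (v x + p) ^ 2) ((v x + p) ^ 2)
      rwa [add_sub_cancel_right] at this
    have k3 : |(v x + p) ^ 2| ≤ M ^ 2 := by
      rw [abs_pow]
      exact pow_le_pow_left₀ (abs_nonneg _) (hv x) 2
    have k4 : (K + C + Q * |v x + p|) / a₀ ≤ (K + C + Q * M) / a₀ :=
      div_le_div_of_nonneg_right (by have := mul_le_mul_of_nonneg_left (hv x) hQ; linarith)
        h.pos.le
    linarith
  · have := h4 x
    simp only [F, truncSq_of_abs_le (hv x)] at this
    rw [riccati, mul_add]
    linarith

lemma IsCorrector.shift {a q c : ℝ → ℝ} {p ε K M Z : ℝ} {w v z : ℝ → ℝ}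
    (h : IsCorrector a q c p ε K M Z w v z) (t : ℝ) :
    IsCorrector (fun x => a (t + x)) (fun x => q (t + x)) (fun x => c (t + x)) p ε K M Z
      (fun x => w (t + x)) (fun x => v (t + x)) (fun x => z (t + x)) where
  deriv_w x := (h.deriv_w (t + x)).comp_const_add t x
  deriv_v x := (h.deriv_v (t + x)).comp_const_add t x
  abs_w _ := h.abs_w _
  abs_v _ := h.abs_v _
  abs_z _ := h.abs_z _
  eq _ := h.eq _

/-- Changing the coefficients by η costs at most η times the bounds on z + (v+p)², v + p and 1. The
difference of squares factors as (u + u')(u - u') with |u + u'| ≤ 2M and is absorbed as a drift. The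
resulting bound does not involve ε. -/
lemma IsCorrector.comparison {a q c a' q' c' : ℝ → ℝ} {p ε K M Z : ℝ} {w v z w' v' z' : ℝ → ℝ}
    (h : IsCorrector a q c p ε K M Z w v z) (h' : IsCorrector a' q' c' p ε K M Z w' v' z')
    (hε : 0 < ε) {A Q : ℝ} (ha0 : ∀ x, 0 ≤ a' x) (haA : ∀ x, a' x ≤ A) (hq : ∀ x, |q' x| ≤ Q)
    {η : ℝ} (hη : ∀ x, |a x - a' x| ≤ η ∧ |q x - q' x| ≤ η ∧ |c x - c' x| ≤ η) (x : ℝ) :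
    ε * (w x - w' x) ≤ η * (Z + M ^ 2) + η * M + η := by
  have hA : 0 ≤ A := (ha0 0).trans (haA 0)
  have hM : 0 ≤ M := (abs_nonneg _).trans (h.abs_v 0)
  have hQ : 0 ≤ Q := (abs_nonneg _).trans (hq 0)
  have hη0 : 0 ≤ η := (abs_nonneg _).trans (hη 0).1
  refine maximum_principle (d := fun x => w x - w' x) (d₁ := fun x => v x - v' x)
    (d₂ := fun x => z x - z' x) (fun x => (h.deriv_w x).sub (h'.deriv_w x))
    (fun x => (h.deriv_v x).sub (h'.deriv_v x)) (C := 2 * (K / ε)) (fun x => ?_) hA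
    (L := A * (2 * M) + Q) (by positivity) hε (fun x => ?_) x
  · have k1 : |w x| ≤ K / ε := by rw [le_div_iff₀ hε, mul_comm]; exact h.abs_w x
    have k2 : |w' x| ≤ K / ε := by rw [le_div_iff₀ hε, mul_comm]; exact h'.abs_w x
    have := abs_le.1 k1
    have := abs_le.1 k2
    linarith
  · obtain ⟨e1, e2, e3⟩ := hη x
    have v1 := h.abs_v x
    have v2 := h'.abs_v x
    set u := v x + p
    set u' := v' x + p
    have hd : v x - v' x = u - u' := by simp only [u, u']; ring
    have k1 : (a x - a' x) * (z x + u ^ 2) ≤ η * (Z + M ^ 2) := by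
      refine (le_abs_self _).trans ?_
      rw [abs_mul]
      refine mul_le_mul e1 ((abs_add_le _ _).trans (add_le_add (h.abs_z x) ?_)) (abs_nonneg _) hη0
      rw [abs_pow]
      exact pow_le_pow_left₀ (abs_nonneg _) v1 2
    have k2 : (q x - q' x) * u ≤ η * M := by
      refine (le_abs_self _).trans ?_
      rw [abs_mul]
      exact mul_le_mul e2 v1 (abs_nonneg _) hη0
    have k3 : a' x * (z x - z' x) ≤ A * max (z x - z' x) 0 :=
      (mul_le_mul_of_nonneg_left (le_max_left _ 0) (ha0 x)).trans
        (mul_le_mul_of_nonneg_right (haA x) (le_max_right _ 0))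
    have k4 : a' x * ((u + u') * (u - u')) ≤ A * (2 * M) * |u - u'| := by
      refine (le_abs_self _).trans ?_
      rw [abs_mul, abs_of_nonneg (ha0 x), abs_mul, mul_assoc]
      have : |u + u'| ≤ 2 * M := (abs_add_le _ _).trans (by linarith)
      gcongr
      exact haA x
    have k5 : q' x * (u - u') ≤ Q * |u - u'| := by
      refine (le_abs_self _).trans ?_
      rw [abs_mul]
      exact mul_le_mul_of_nonneg_right (hq x) (abs_nonneg _)
    have k6 := (abs_le.1 e3).2
    have k7 : a x * (z x + u ^ 2) + q x * u + c x = ε * w x := h.eq x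
    have k8 : a' x * (z' x + u' ^ 2) + q' x * u' + c' x = ε * w' x := h'.eq x
    rw [hd]
    nlinarith

/-! ### Almost periodic coefficients -/

/-- Three successive extractions give a common subsequence; two late terms are both within η/2 of
the uniform limits. -/
lemma AlmostPeriodic.joint {a q c : ℝ → ℝ} (ha : AlmostPeriodic a) (hq : AlmostPeriodic q)
    (hc : AlmostPeriodic c) (y : ℕ → ℝ) {η : ℝ} (hη : 0 < η) :
    ∃ m n, m < n ∧ ∀ x, |a (y n + x) - a (y m + x)| ≤ η ∧ |q (y n + x) - q (y m + x)| ≤ η ∧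
      |c (y n + x) - c (y m + x)| ≤ η := by
  obtain ⟨k1, hk1, g1, hg1⟩ := ha y
  obtain ⟨k2, hk2, g2, hg2⟩ := hq (y ∘ k1)
  obtain ⟨k3, hk3, g3, hg3⟩ := hc (y ∘ k1 ∘ k2)
  rw [Metric.tendstoUniformly_iff] at hg1 hg2 hg3
  have e1 := (hk2.comp hk3).tendsto_atTop.eventually (hg1 (η / 2) (by positivity))
  have e2 := hk3.tendsto_atTop.eventually (hg2 (η / 2) (by positivity))
  have e3 := hg3 (η / 2) (by positivity)
  obtain ⟨N, hN⟩ := eventually_atTop.1 (e1.and (e2.and e3))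
  refine ⟨k1 (k2 (k3 N)), k1 (k2 (k3 (N + 1))), hk1 (hk2 (hk3 (Nat.lt_succ_self N))), fun x => ?_⟩
  obtain ⟨a1, a2, a3⟩ := hN N le_rfl
  obtain ⟨b1, b2, b3⟩ := hN (N + 1) (Nat.le_succ N)
  have aux : ∀ r s t : ℝ, dist r s < η / 2 → dist r t < η / 2 → |t - s| ≤ η := by
    intro r s t h1 h2
    rw [Real.dist_eq] at h1 h2
    have := abs_lt.1 h1
    have := abs_lt.1 h2
    rw [abs_le]
    constructor <;> linarith
  exact ⟨aux _ _ _ (a1 x) (b1 x), aux _ _ _ (a2 x) (b2 x), aux _ _ _ (a3 x) (b3 x)⟩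

/-- Total boundedness of the set of translates: without a finite net one builds inductively an
η-separated sequence, against `AlmostPeriodic.joint`. -/
lemma AlmostPeriodic.exists_finite_net {a q c : ℝ → ℝ} (ha : AlmostPeriodic a)
    (hq : AlmostPeriodic q) (hc : AlmostPeriodic c) {η : ℝ} (hη : 0 < η) :
    ∃ s : Finset ℝ, ∀ t, ∃ r ∈ s, ∀ x, |a (t + x) - a (r + x)| ≤ η ∧
      |q (t + x) - q (r + x)| ≤ η ∧ |c (t + x) - c (r + x)| ≤ η := by
  by_contra! hcon
  obtain ⟨y, -, hy⟩ := exists_seq_of_forall_finset_exists (fun _ : ℝ => True)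
    (fun r t => ¬ ∀ x, |a (t + x) - a (r + x)| ≤ η ∧
      |q (t + x) - q (r + x)| ≤ η ∧ |c (t + x) - c (r + x)| ≤ η) (fun s _ => by
      obtain ⟨t, ht⟩ := hcon s
      refine ⟨t, trivial, fun r hr hall => ?_⟩
      obtain ⟨x, hx⟩ := ht r hr
      exact absurd (hall x).2.2 (not_le.2 (hx (hall x).1 (hall x).2.1)))
  obtain ⟨m, n, hmn, h⟩ := ha.joint hq hc y hη
  exact hy m n hmn h

lemma AlmostPeriodic.exists_large_almostPeriod {a q c : ℝ → ℝ} (ha : AlmostPeriodic a)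
    (hq : AlmostPeriodic q) (hc : AlmostPeriodic c) {η : ℝ} (hη : 0 < η) (X : ℝ) :
    ∃ t ≥ X, ∀ x, |a (x + t) - a x| ≤ η ∧ |q (x + t) - q x| ≤ η ∧ |c (x + t) - c x| ≤ η := by
  -- Two distinct multiples of |X| differ by at least |X|, so their difference is an almost period
  -- beyond X.
  obtain ⟨m, n, hmn, h⟩ := ha.joint hq hc (fun n : ℕ => n * |X|) hη
  refine ⟨((n : ℝ) - m) * |X|, ?_, fun x => ?_⟩
  · have : (1 : ℝ) ≤ n - m := by
      have : (m : ℝ) + 1 ≤ n := by exact_mod_cast hmn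
      linarith
    have := le_abs_self X
    have := abs_nonneg X
    nlinarith
  · have e1 : (n : ℝ) * |X| + (x - m * |X|) = x + (n - m) * |X| := by ring
    have e2 : (m : ℝ) * |X| + (x - m * |X|) = x := by ring
    have := h (x - m * |X|)
    simpa only [e1, e2] using this

/-- For almost periodic coefficients there are approximate correctors. -/
theorem exists_approx_corrector {a q c : ℝ → ℝ} {a₀ A Q C : ℝ}
    (h : EllipticCoeff a q c a₀ A Q C) (ha : AlmostPeriodic a) (hq : AlmostPeriodic q)
    (hc : AlmostPeriodic c) (p : ℝ) {δ : ℝ} (hδ : 0 < δ) :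
    ∃ (l : ℝ) (w v z : ℝ → ℝ), BoundedProfile w v z ∧
      ∀ x, |riccati a q c p v z x - l| ≤ δ := by
  obtain ⟨K, M, Z, hcor⟩ := exists_corrector h p
  obtain ⟨w₁, v₁, z₁, hc1⟩ := hcor 1 one_pos
  have hM : 0 ≤ M := (abs_nonneg _).trans (hc1.abs_v 0)
  have hZ : 0 ≤ Z := (abs_nonneg _).trans (hc1.abs_z 0)
  -- Half of δ pays for replacing t by a net point r, the other half for moving from r to 0. The
  -- net, and so its radius ℓ, depends only on η and is fixed before ε; then ε makes ε(M + |p|)ℓ at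
  -- most δ/2.
  set η := δ / (2 * (Z + M ^ 2 + M + 1)) with hη
  have hη0 : 0 < η := by positivity
  obtain ⟨s, hs⟩ := ha.exists_finite_net hq hc hη0
  obtain ⟨ℓ, hℓ⟩ : ∃ ℓ : ℝ, ∀ r ∈ s, |r| ≤ ℓ :=
    ⟨∑ r ∈ s, |r|, fun r hr => Finset.single_le_sum (fun i _ => abs_nonneg i) hr⟩
  set ε := δ / (2 * ((M + |p|) * |ℓ| + 1)) with hε
  have hε0 : 0 < ε := by positivity
  obtain ⟨w, v, z, hw⟩ := hcor ε hε0
  have hv : ∀ x, |v x| ≤ M + |p| := fun x => by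
    have : |v x| ≤ |v x + p| + |p| := by simpa using abs_sub (v x + p) p
    exact this.trans (add_le_add_left (hw.abs_v x) _)
  have hcont : Continuous z := by
    have hwc : Continuous w := continuous_iff_continuousAt.2 fun x => (hw.deriv_w x).continuousAt
    have hvc : Continuous v := continuous_iff_continuousAt.2 fun x => (hw.deriv_v x).continuousAt
    have hne : ∀ x, a x ≠ 0 := fun x => (h.pos.trans_le (h.le_a x)).ne'
    have e : z = fun x => (ε * w x - q x * (v x + p) - c x) / a x - (v x + p) ^ 2 := by
      ext x
      have := hw.eq x
      rw [riccati] at this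
      rw [← this]
      field_simp [hne x]
      ring
    have := h.a_cont
    have := h.q_cont
    have := h.c_cont
    rw [e]
    exact (Continuous.div (by fun_prop) (by fun_prop) hne).sub (by fun_prop)
  refine ⟨ε * w 0, w, v, z, ⟨hw.deriv_w, hw.deriv_v, hcont, ⟨K / ε, fun x => ?_⟩, ⟨_, hv⟩,
    ⟨Z, hw.abs_z⟩⟩, fun t => ?_⟩
  · rw [le_div_iff₀ hε0, mul_comm]
    exact hw.abs_w x
  rw [hw.eq, ← mul_sub, abs_mul, abs_of_pos hε0]
  obtain ⟨r, hr, hrt⟩ := hs t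
  have c1 := (hw.shift t).comparison (hw.shift r) hε0 (A := A) (Q := Q)
    (fun x => (h.pos.trans_le (h.le_a _)).le) (fun x => h.a_le _) (fun x => h.abs_q_le _) hrt 0
  have c2 := (hw.shift r).comparison (hw.shift t) hε0 (A := A) (Q := Q) (η := η)
    (fun x => (h.pos.trans_le (h.le_a _)).le) (fun x => h.a_le _) (fun x => h.abs_q_le _)
    (fun x => by simpa only [abs_sub_comm] using hrt x) 0
  simp only [add_zero] at c1 c2
  have c3 : η * (Z + M ^ 2) + η * M + η = δ / 2 := by
    rw [hη]; field_simp
  have c4 : |w r - w 0| ≤ (M + |p|) * |ℓ| := by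
    have := Convex.norm_image_sub_le_of_norm_hasDerivWithin_le (f := w) (f' := v)
      (C := M + |p|) (s := univ) (fun x _ => (hw.deriv_w x).hasDerivWithinAt)
      (fun x _ => by simpa using hv x) convex_univ (mem_univ 0) (mem_univ r)
    simp only [Real.norm_eq_abs, sub_zero] at this
    refine this.trans (mul_le_mul_of_nonneg_left ((hℓ r hr).trans (le_abs_self ℓ)) (by positivity))
  have c5 : ε * |w r - w 0| ≤ δ / 2 := by
    refine (mul_le_mul_of_nonneg_left c4 hε0.le).trans ?_
    rw [hε, div_mul_eq_mul_div, div_le_div_iff₀ (by positivity) (by positivity)]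
    nlinarith
  have c6 : ε * |w t - w r| ≤ δ / 2 := by
    rcases abs_cases (w t - w r) with h | h <;> rw [h.1] <;> linarith
  calc ε * |w t - w 0| ≤ ε * (|w t - w r| + |w r - w 0|) :=
        mul_le_mul_of_nonneg_left (abs_sub_le _ _ _) hε0.le
    _ ≤ δ := by linarith

/-! ### Test functions and their logarithmic derivatives -/

lemma conjOp_eq {a q c φ φ₁ : ℝ → ℝ} {p s x : ℝ} (h₁ : ∀ᶠ y in 𝓝 x, HasDerivAt φ (φ₁ y) y)
    (h₂ : HasDerivAt φ₁ s x) :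
    conjOp a q c p φ x = a x * (s + 2 * p * φ₁ x + p ^ 2 * φ x) + q x * (φ₁ x + p * φ x) +
      c x * φ x := by
  have hexp : ∀ y, HasDerivAt (fun y : ℝ => Real.exp (p * y)) (Real.exp (p * y) * p) y := by
    intro y
    simpa using ((hasDerivAt_id y).const_mul p).exp
  have hd : ∀ᶠ y in 𝓝 x, deriv (fun y => Real.exp (p * y) * φ y) y =
      Real.exp (p * y) * p * φ y + Real.exp (p * y) * φ₁ y := by
    filter_upwards [h₁] with y hy using ((hexp y).mul hy).deriv
  have hd2 : deriv (deriv fun y => Real.exp (p * y) * φ y) x =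
      Real.exp (p * x) * p * p * φ x + Real.exp (p * x) * p * φ₁ x +
        (Real.exp (p * x) * p * φ₁ x + Real.exp (p * x) * s) := by
    rw [EventuallyEq.deriv_eq hd]
    exact ((((hexp x).mul_const p).mul h₁.self_of_nhds).add ((hexp x).mul h₂)).deriv
  have he : Real.exp (-(p * x)) * Real.exp (p * x) = 1 := by rw [← Real.exp_add]; simp
  rw [conjOp, ellOp, hd2, hd.self_of_nhds]
  linear_combination (a x * (s + 2 * p * φ₁ x + p ^ 2 * φ x) + q x * (φ₁ x + p * φ x) +
      c x * φ x) * he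

/-- The logarithmic derivatives of an admissible test function on `(R,∞)`. -/
structure HalfProfile (R : ℝ) (w v z : ℝ → ℝ) : Prop where
  deriv_w : ∀ x ∈ Ioi R, HasDerivAt w (v x) x
  deriv_v : ∀ x ∈ Ioi R, HasDerivAt v (z x) x
  bdd_v : ∃ C, ∀ x ∈ Ioi R, |v x| ≤ C
  tendsto_w : Tendsto (fun x => w x / x) atTop (𝓝 0)

lemma exists_halfProfile {R : ℝ} {φ : ℝ → ℝ} (hφ : φ ∈ admissibleHalf R) :
    ∃ w v z, HalfProfile R w v z ∧ ∀ (a q c : ℝ → ℝ) (p : ℝ), ∀ x ∈ Ioi R,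
      conjOp a q c p φ x = riccati a q c p v z x * φ x := by
  obtain ⟨-, h2, ⟨M, hM⟩, hpos, hlim⟩ := hφ
  have hp : ∀ x ∈ Ioi R, 0 < φ x := fun x hx => hpos x (mem_Ici_of_Ioi hx)
  have hd1 : ∀ x ∈ Ioi R, HasDerivAt φ (deriv φ x) x := fun x hx =>
    ((h2.differentiableOn (by norm_num)).differentiableAt (isOpen_Ioi.mem_nhds hx)).hasDerivAt
  have hd2 : ∀ x ∈ Ioi R, HasDerivAt (deriv φ) (deriv (deriv φ) x) x := fun x hx => by
    have h3 : ContDiffOn ℝ 1 (deriv φ) (Ioi R) :=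
      h2.deriv_of_isOpen isOpen_Ioi (by norm_num)
    exact ((h3.differentiableOn (by norm_num)).differentiableAt
      (isOpen_Ioi.mem_nhds hx)).hasDerivAt
  refine ⟨fun x => Real.log (φ x), fun x => deriv φ x / φ x,
    fun x => (deriv (deriv φ) x * φ x - deriv φ x * deriv φ x) / φ x ^ 2,
    ⟨fun x hx => (hd1 x hx).log (hp x hx).ne', fun x hx => (hd2 x hx).div (hd1 x hx) (hp x hx).ne',
      ⟨M, hM⟩, ?_⟩, fun a q c p x hx => ?_⟩
  · refine hlim.congr fun x => ?_
    ring
  · rw [conjOp_eq (Filter.eventually_of_mem (isOpen_Ioi.mem_nhds hx) hd1) (hd2 x hx), riccati]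
    have := (hp x hx).ne'
    field_simp
    ring

lemma admissibleLine_subset_half (R : ℝ) : admissibleLine ⊆ admissibleHalf R := by
  rintro φ ⟨h1, ⟨M, hM⟩, h3, h4⟩
  exact ⟨(h1.of_le (by norm_num)).contDiffOn, h1.contDiffOn, ⟨M, fun x _ => hM x⟩,
    fun x _ => h3 x, h4.mono_left atTop_le_cocompact⟩

lemma BoundedProfile.exp_mem {w v z : ℝ → ℝ} (h : BoundedProfile w v z) :
    (fun x => Real.exp (w x)) ∈ admissibleLine := by
  have hdw : deriv w = v := funext fun x => (h.deriv_w x).deriv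
  have hdv : deriv v = z := funext fun x => (h.deriv_v x).deriv
  have hv : ContDiff ℝ 1 v := contDiff_one_iff_deriv.2
    ⟨fun x => (h.deriv_v x).differentiableAt, by rw [hdv]; exact h.cont_z⟩
  have hw : ContDiff ℝ 2 w := by
    rw [show (2 : WithTop ℕ∞) = 1 + 1 by norm_num, contDiff_succ_iff_deriv]
    exact ⟨fun x => (h.deriv_w x).differentiableAt, by simp, by rw [hdw]; exact hv⟩
  obtain ⟨C, hC⟩ := h.bdd_w
  obtain ⟨C', hC'⟩ := h.bdd_v
  refine ⟨hw.exp, ⟨C', fun x => ?_⟩, fun x => Real.exp_pos _, ?_⟩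
  · rw [(h.deriv_w x).exp.deriv, mul_div_assoc, mul_comm, div_mul_cancel₀ _ (Real.exp_pos _).ne']
    exact hC' x
  · have h0 : Tendsto (fun x : ℝ => ‖x‖⁻¹ * C) (cocompact ℝ) (𝓝 (0 * C)) :=
      (tendsto_inv_atTop_zero.comp (tendsto_norm_cocompact_atTop (E := ℝ))).mul_const C
    rw [zero_mul] at h0
    refine squeeze_zero_norm (fun x => ?_) h0
    rw [Real.log_exp, norm_mul, norm_div, norm_one, one_div]
    exact mul_le_mul_of_nonneg_left (hC x) (by positivity)

lemma BoundedProfile.conjOp_exp {w v z : ℝ → ℝ} (h : BoundedProfile w v z) (a q c : ℝ → ℝ)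
    (p x : ℝ) : conjOp a q c p (fun x => Real.exp (w x)) x =
      riccati a q c p v z x * Real.exp (w x) := by
  rw [conjOp_eq (Eventually.of_forall fun y => (h.deriv_w y).exp)
    ((h.deriv_w x).exp.mul (h.deriv_v x)), riccati]
  ring

/-! ### Comparison of the two eigenvalues -/

lemma not_tendsto_of_le_deriv {D d : ℝ → ℝ} {x₁ s : ℝ} (hs : 0 < s)
    (hD : ∀ x ∈ Ici x₁, HasDerivAt D (d x) x) (hd : ∀ x ∈ Ici x₁, s ≤ d x) :
    ¬ Tendsto (fun x => D x / x) atTop (𝓝 0) := by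
  intro hlim
  have h1 := hlim.eventually (gt_mem_nhds (by positivity : (0 : ℝ) < s / 2))
  obtain ⟨x, hx1, hx2, hx3, hx4⟩ := (h1.and ((eventually_ge_atTop x₁).and
    ((eventually_gt_atTop 0).and (eventually_gt_atTop (2 / s * (s * x₁ - D x₁)))))).exists
  have h2 := mul_sub_le_of_le_hasDerivAt (convex_Ici x₁) hD hd self_mem_Ici hx2 hx2
  rw [div_lt_iff₀ hx3] at hx1
  have h3 : s / 2 * (2 / s * (s * x₁ - D x₁)) < s / 2 * x :=
    mul_lt_mul_of_pos_left hx4 (by positivity)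
  have h4 : s / 2 * (2 / s * (s * x₁ - D x₁)) = s * x₁ - D x₁ := by field_simp
  nlinarith

lemma le_of_barrier {d d' : ℝ → ℝ} {x₁ m : ℝ} (hd : ∀ x ∈ Ici x₁, HasDerivAt d (d' x) x)
    (h0 : m ≤ d x₁) (hm : ∀ x ∈ Ici x₁, d x = m → 0 < d' x) : ∀ x ∈ Ici x₁, m ≤ d x := by
  intro x hx
  exact image_le_of_deriv_right_lt_deriv_boundary' (f := fun _ => m) (f' := fun _ => 0)
    (B := d) (B' := d') (a := x₁) (b := x) continuousOn_const
    (fun y _ => hasDerivWithinAt_const _ _ _) h0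
    (fun y hy => (hd y hy.1).continuousAt.continuousWithinAt)
    (fun y hy => (hd y hy.1).hasDerivWithinAt) (fun y hy e => hm y hy.1 e.symm) ⟨hx, le_rfl⟩

/-- Suppose l > l' and put d = v - v'. Subtracting the two inequalities shows that d increases at a
definite rate while |d| ≤ κ. Hence either d < -κ throughout, or d crosses the strip and stays above
κ. In both cases w - w' is eventually at least linear in absolute value, although (w - w')/x → 0. -/
theorem HalfProfile.comparison {a q c : ℝ → ℝ} {a₀ A Q p R l l' : ℝ} {w v z w' v' z' : ℝ → ℝ}
    (ha₀ : 0 < a₀) (hal : ∀ x, a₀ ≤ a x) (hau : ∀ x, a x ≤ A) (hq : ∀ x, |q x| ≤ Q)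
    (h : HalfProfile R w v z) (h' : HalfProfile R w' v' z')
    (hl : ∀ x ∈ Ioi R, l ≤ riccati a q c p v z x)
    (hl' : ∀ x ∈ Ioi R, riccati a q c p v' z' x ≤ l') : l ≤ l' := by
  by_contra! hlt
  have hA : 0 < A := ha₀.trans_le ((hal 0).trans (hau 0))
  have hQ : 0 ≤ Q := (abs_nonneg _).trans (hq 0)
  obtain ⟨C, hC⟩ := h.bdd_v
  obtain ⟨C', hC'⟩ := h'.bdd_v
  set δ := l - l' with hδ
  have hδ0 : 0 < δ := by linarith
  set B := A * (|C| + |C'| + 2 * |p|) + Q + 1 with hB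
  have hB0 : 0 < B := by positivity
  -- B bounds the coefficient of v - v' in the difference of the two Riccati expressions, so |v -
  -- v'| ≤ κ uses up at most half of the gap δ.
  set κ := δ / (2 * B) with hκ
  have hκ0 : 0 < κ := by positivity
  have hmain : ∀ x ∈ Ioi R, |v x - v' x| ≤ κ → δ / (2 * A) ≤ z x - z' x := by
    intro x hx hd
    have e : δ ≤ a x * (z x - z' x) + (a x * (v x + v' x + 2 * p) + q x) * (v x - v' x) := by
      have := hl x hx
      have := hl' x hx
      simp only [riccati] at *
      nlinarith
    have hap : 0 < a x := ha₀.trans_le (hal x)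
    have e2 : (a x * (v x + v' x + 2 * p) + q x) * (v x - v' x) ≤ δ / 2 := by
      refine (le_abs_self _).trans ?_
      rw [abs_mul]
      have b1 : |a x * (v x + v' x + 2 * p) + q x| ≤ B := by
        have b2 : |v x + v' x + 2 * p| ≤ |C| + |C'| + 2 * |p| := by
          refine (abs_add_le _ _).trans (add_le_add ((abs_add_le _ _).trans (add_le_add
            ((hC x hx).trans (le_abs_self _)) ((hC' x hx).trans (le_abs_self _)))) ?_)
          rw [abs_mul, abs_two]
        refine (abs_add_le _ _).trans ?_
        rw [abs_mul, abs_of_pos hap]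
        have := mul_le_mul (hau x) b2 (abs_nonneg _) hA.le
        have := hq x
        linarith
      calc |a x * (v x + v' x + 2 * p) + q x| * |v x - v' x| ≤ B * κ :=
            mul_le_mul b1 hd (abs_nonneg _) hB0.le
        _ = δ / 2 := by rw [hκ]; field_simp
    have e3 : δ / 2 ≤ a x * (z x - z' x) := by linarith
    have e4 : 0 < z x - z' x := by
      by_contra! hn
      nlinarith
    rw [div_le_iff₀ (by positivity)]
    have := mul_le_mul_of_nonneg_right (hau x) e4.le
    linarith
  have hs : 0 < δ / (2 * A) := by positivity
  have hdd : ∀ x ∈ Ioi R, HasDerivAt (fun x => v x - v' x) (z x - z' x) x := fun x hx =>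
    (h.deriv_v x hx).sub (h'.deriv_v x hx)
  have hDD : ∀ x ∈ Ioi R, HasDerivAt (fun x => w x - w' x) (v x - v' x) x := fun x hx =>
    (h.deriv_w x hx).sub (h'.deriv_w x hx)
  have hlim : Tendsto (fun x => (w x - w' x) / x) atTop (𝓝 0) := by
    have := h.tendsto_w.sub h'.tendsto_w
    rw [sub_zero] at this
    exact this.congr fun x => (sub_div _ _ _).symm
  have hlim' : Tendsto (fun x => -(w x - w' x) / x) atTop (𝓝 0) := by
    have := hlim.neg
    rw [neg_zero] at this
    exact this.congr fun x => (neg_div _ _).symm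
  by_cases hcase : ∃ x₀ ∈ Ioi R, -κ ≤ v x₀ - v' x₀
  · obtain ⟨x₀, hx₀, hd0⟩ := hcase
    have hsub : ∀ x₁ ∈ Ici x₀, ∀ x ∈ Ici x₁, x ∈ Ioi R := fun x₁ h1 x h2 =>
      lt_of_lt_of_le (mem_Ioi.1 hx₀) (le_trans (mem_Ici.1 h1) (mem_Ici.1 h2))
    have hge : ∀ x ∈ Ici x₀, -κ ≤ v x - v' x :=
      le_of_barrier (fun x hx => hdd x (hsub x₀ self_mem_Ici x hx)) hd0 fun x hx e =>
        hs.trans_le (hmain x (hsub x₀ self_mem_Ici x hx) (by rw [e, abs_neg, abs_of_pos hκ0]))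
    -- The strip has width 2κ and the slope inside it is at least δ/(2A), so it is left through the
    -- top within length 2κ/(δ/(2A)).
    obtain ⟨x₁, hx₁, hd1⟩ : ∃ x₁ ∈ Ici x₀, κ ≤ v x₁ - v' x₁ := by
      by_contra! hcon
      have hz : ∀ x ∈ Ici x₀, δ / (2 * A) ≤ z x - z' x := fun x hx =>
        hmain x (hsub x₀ self_mem_Ici x hx) (abs_le.2 ⟨hge x hx, (hcon x hx).le⟩)
      set T := x₀ + 2 * κ / (δ / (2 * A)) with hT
      have hTx : T ∈ Ici x₀ := by
        have : 0 ≤ 2 * κ / (δ / (2 * A)) := by positivity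
        simp only [mem_Ici, hT]; linarith
      have := mul_sub_le_of_le_hasDerivAt (convex_Ici x₀)
        (fun x hx => hdd x (hsub x₀ self_mem_Ici x hx)) hz self_mem_Ici hTx hTx
      have e : δ / (2 * A) * (T - x₀) = 2 * κ := by rw [hT]; field_simp; ring
      have := hge x₀ self_mem_Ici
      have := hcon T hTx
      linarith
    have hge2 : ∀ x ∈ Ici x₁, κ ≤ v x - v' x :=
      le_of_barrier (fun x hx => hdd x (hsub x₁ hx₁ x hx)) hd1 fun x hx e =>
        hs.trans_le (hmain x (hsub x₁ hx₁ x hx) (by rw [e, abs_of_pos hκ0]))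
    exact not_tendsto_of_le_deriv hκ0 (fun x hx => hDD x (hsub x₁ hx₁ x hx)) hge2 hlim
  · push Not at hcase
    have hsub : ∀ x ∈ Ici (R + 1), x ∈ Ioi R := fun x hx =>
      lt_of_lt_of_le (lt_add_one R) hx
    exact not_tendsto_of_le_deriv (D := fun x => -(w x - w' x)) (d := fun x => -(v x - v' x))
      (x₁ := R + 1) hκ0 (fun x hx => (hDD x (hsub x hx)).neg)
      (fun x hx => by have := hcase x (hsub x hx); linarith) hlim'

lemma lowerEigHalf_le_upperEigHalf {a q : ℝ → ℝ} (c : ℝ → ℝ) {a₀ A Q : ℝ}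
    (ha₀ : 0 < a₀) (hal : ∀ x, a₀ ≤ a x) (hau : ∀ x, a x ≤ A) (hq : ∀ x, |q x| ≤ Q) (p R : ℝ) :
    lowerEigHalf (conjOp a q c p) R ≤ upperEigHalf (conjOp a q c p) R := by
  refine sSup_le ?_
  rintro _ ⟨l, rfl, φ, hφ, hl⟩
  refine le_sInf ?_
  rintro _ ⟨l', rfl, ψ, hψ, hl'⟩
  obtain ⟨w, v, z, hp, he⟩ := exists_halfProfile hφ
  obtain ⟨w', v', z', hp', he'⟩ := exists_halfProfile hψ
  rw [EReal.coe_le_coe_iff]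
  refine hp.comparison ha₀ hal hau hq hp' (fun x hx => ?_) (fun x hx => ?_) (c := c) (p := p)
  · have := hl x hx
    rw [he a q c p x hx] at this
    exact le_of_mul_le_mul_right this (hφ.2.2.2.1 x (mem_Ici_of_Ioi hx))
  · have := hl' x hx
    rw [he' a q c p x hx] at this
    exact le_of_mul_le_mul_right this (hψ.2.2.2.1 x (mem_Ici_of_Ioi hx))

lemma lowerEigLine_le_lowerEigHalf (L : (ℝ → ℝ) → ℝ → ℝ) (R : ℝ) :
    lowerEigLine L ≤ lowerEigHalf L R := by
  refine sSup_le_sSup ?_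
  rintro _ ⟨l, rfl, φ, hφ, hl⟩
  exact ⟨l, rfl, φ, admissibleLine_subset_half R hφ, fun x _ => hl x (mem_univ x)⟩

lemma upperEigHalf_le_upperEigLine (L : (ℝ → ℝ) → ℝ → ℝ) (R : ℝ) :
    upperEigHalf L R ≤ upperEigLine L := by
  refine sInf_le_sInf ?_
  rintro _ ⟨l, rfl, φ, hφ, hl⟩
  exact ⟨l, rfl, φ, admissibleLine_subset_half R hφ, fun x _ => hl x (mem_univ x)⟩

section Bounds

variable {a q c : ℝ → ℝ} {p l R : ℝ} {w v z : ℝ → ℝ}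

lemma BoundedProfile.le_lowerEigHalf (h : BoundedProfile w v z)
    (hl : ∀ x ∈ Ioi R, l ≤ riccati a q c p v z x) :
    (l : EReal) ≤ lowerEigHalf (conjOp a q c p) R :=
  le_sSup ⟨l, rfl, _, admissibleLine_subset_half R h.exp_mem, fun x hx => by
    rw [h.conjOp_exp]
    exact mul_le_mul_of_nonneg_right (hl x hx) (Real.exp_pos _).le⟩

lemma BoundedProfile.upperEigHalf_le (h : BoundedProfile w v z)
    (hl : ∀ x ∈ Ioi R, riccati a q c p v z x ≤ l) :
    upperEigHalf (conjOp a q c p) R ≤ (l : EReal) :=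
  sInf_le ⟨l, rfl, _, admissibleLine_subset_half R h.exp_mem, fun x hx => by
    rw [h.conjOp_exp]
    exact mul_le_mul_of_nonneg_right (hl x hx) (Real.exp_pos _).le⟩

lemma BoundedProfile.le_lowerEigLine (h : BoundedProfile w v z)
    (hl : ∀ x, l ≤ riccati a q c p v z x) :
    (l : EReal) ≤ lowerEigLine (conjOp a q c p) :=
  le_sSup ⟨l, rfl, _, h.exp_mem, fun x _ => by
    rw [h.conjOp_exp]
    exact mul_le_mul_of_nonneg_right (hl x) (Real.exp_pos _).le⟩

lemma BoundedProfile.upperEigLine_le (h : BoundedProfile w v z)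
    (hl : ∀ x, riccati a q c p v z x ≤ l) :
    upperEigLine (conjOp a q c p) ≤ (l : EReal) :=
  sInf_le ⟨l, rfl, _, h.exp_mem, fun x _ => by
    rw [h.conjOp_exp]
    exact mul_le_mul_of_nonneg_right (hl x) (Real.exp_pos _).le⟩

end Bounds

/-! ### The effective Hamiltonian -/

/-- `l` is the effective Hamiltonian at `p`: there are approximate correctors for it. -/
def IsEffective (a q c : ℝ → ℝ) (p l : ℝ) : Prop :=
  ∀ δ > 0, ∃ w v z : ℝ → ℝ, BoundedProfile w v z ∧ ∀ x, |riccati a q c p v z x - l| ≤ δ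

section Effective

variable {a q c : ℝ → ℝ} {a₀ A Q C : ℝ}

lemma EllipticCoeff.lower_le_upper (h : EllipticCoeff a q c a₀ A Q C) (p : ℝ) :
    lowerEigLine (conjOp a q c p) ≤ upperEigLine (conjOp a q c p) :=
  (lowerEigLine_le_lowerEigHalf _ 0).trans <|
    (lowerEigHalf_le_upperEigHalf c h.pos h.le_a h.a_le h.abs_q_le p 0).trans
      (upperEigHalf_le_upperEigLine _ 0)

lemma EllipticCoeff.profile_comparison (h : EllipticCoeff a q c a₀ A Q C) {p l l' : ℝ}
    {w v z w' v' z' : ℝ → ℝ} (hp : BoundedProfile w v z) (hp' : BoundedProfile w' v' z')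
    (hl : ∀ x, l ≤ riccati a q c p v z x) (hl' : ∀ x, riccati a q c p v' z' x ≤ l') : l ≤ l' :=
  EReal.coe_le_coe_iff.1 <| (hp.le_lowerEigLine hl).trans <|
    (h.lower_le_upper p).trans (hp'.upperEigLine_le hl')

/-- By comparison any two intervals [l n - 1/(n+1), l n + 1/(n+1)] meet, so the supremum of the left
endpoints lies in all of them; no rate of convergence is needed. -/
theorem exists_isEffective (h : EllipticCoeff a q c a₀ A Q C) (ha : AlmostPeriodic a)
    (hq : AlmostPeriodic q) (hc : AlmostPeriodic c) (p : ℝ) : ∃ l, IsEffective a q c p l := by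
  choose l w v z hp hl using fun n : ℕ =>
    exists_approx_corrector h ha hq hc p (δ := 1 / ((n : ℝ) + 1)) (by positivity)
  have hle : ∀ m n, l m - 1 / ((m : ℝ) + 1) ≤ l n + 1 / ((n : ℝ) + 1) := fun m n =>
    h.profile_comparison (hp m) (hp n) (p := p)
      (fun x => by have := abs_le.1 (hl m x); linarith)
      (fun x => by have := abs_le.1 (hl n x); linarith)
  set S := ⨆ m, (l m - 1 / ((m : ℝ) + 1)) with hS
  have hbdd : BddAbove (range fun m => l m - 1 / ((m : ℝ) + 1)) :=
    ⟨_, by rintro _ ⟨m, rfl⟩; exact hle m 0⟩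
  refine ⟨S, fun δ hδ => ?_⟩
  obtain ⟨n, hn⟩ := exists_nat_one_div_lt (half_pos hδ)
  refine ⟨w n, v n, z n, hp n, fun x => ?_⟩
  have h1 : l n - 1 / ((n : ℝ) + 1) ≤ S := le_ciSup hbdd n
  have h2 : S ≤ l n + 1 / ((n : ℝ) + 1) := ciSup_le fun m => hle m n
  have := abs_le.1 (hl n x)
  rw [abs_le]
  constructor <;> linarith

lemma IsEffective.le_of_profile (h : EllipticCoeff a q c a₀ A Q C) {p l m : ℝ}
    (he : IsEffective a q c p l) {w v z : ℝ → ℝ} (hp : BoundedProfile w v z)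
    (hm : ∀ x, riccati a q c p v z x ≤ m) : l ≤ m := by
  refine le_of_forall_pos_le_add fun δ hδ => ?_
  obtain ⟨w', v', z', hp', hl⟩ := he δ hδ
  have := h.profile_comparison (l := l - δ) hp' hp
    (fun x => by have := abs_le.1 (hl x); linarith) hm
  linarith

lemma IsEffective.ge_of_profile (h : EllipticCoeff a q c a₀ A Q C) {p l m : ℝ}
    (he : IsEffective a q c p l) {w v z : ℝ → ℝ} (hp : BoundedProfile w v z)
    (hm : ∀ x, m ≤ riccati a q c p v z x) : m ≤ l := by
  refine le_of_forall_pos_le_add fun δ hδ => ?_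
  obtain ⟨w', v', z', hp', hl⟩ := he δ hδ
  exact h.profile_comparison (l' := l + δ) hp hp' hm
    (fun x => by have := abs_le.1 (hl x); linarith)

lemma coe_le_of_forall_pos {l : ℝ} {X : EReal} (h : ∀ δ > 0, ((l - δ : ℝ) : EReal) ≤ X) :
    (l : EReal) ≤ X := by
  refine le_of_forall_lt fun b hb => ?_
  obtain ⟨r, hr1, hr2⟩ := EReal.lt_iff_exists_real_btwn.1 hb
  have hr2' : r < l := by exact_mod_cast hr2
  have := h (l - r) (by linarith)
  rw [sub_sub_cancel] at this
  exact hr1.trans_le this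

lemma le_coe_of_forall_pos {l : ℝ} {X : EReal} (h : ∀ δ > 0, X ≤ ((l + δ : ℝ) : EReal)) :
    X ≤ (l : EReal) := by
  refine le_of_forall_gt fun b hb => ?_
  obtain ⟨r, hr1, hr2⟩ := EReal.lt_iff_exists_real_btwn.1 hb
  have hr1' : l < r := by exact_mod_cast hr1
  have := h (r - l) (by linarith)
  rw [add_sub_cancel] at this
  exact this.trans_lt hr2

theorem IsEffective.eigLine_eq (h : EllipticCoeff a q c a₀ A Q C) {p l : ℝ}
    (he : IsEffective a q c p l) :
    upperEigLine (conjOp a q c p) = l ∧ lowerEigLine (conjOp a q c p) = l := by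
  have h1 : (l : EReal) ≤ lowerEigLine (conjOp a q c p) := coe_le_of_forall_pos fun δ hδ => by
    obtain ⟨w, v, z, hp, hl⟩ := he δ hδ
    exact hp.le_lowerEigLine fun x => by have := abs_le.1 (hl x); linarith
  have h2 : upperEigLine (conjOp a q c p) ≤ (l : EReal) := le_coe_of_forall_pos fun δ hδ => by
    obtain ⟨w, v, z, hp, hl⟩ := he δ hδ
    exact hp.upperEigLine_le fun x => by have := abs_le.1 (hl x); linarith
  have h3 := h.lower_le_upper p
  exact ⟨le_antisymm h2 (h1.trans h3), le_antisymm (h3.trans h2) h1⟩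

/-- Coefficients which are asymptotic at `+∞` to `a, q, c` have the same Hamiltonian. -/
theorem IsEffective.tendsto_eigHalf {a' q' c' : ℝ → ℝ} (ha₀ : 0 < a₀) (hal : ∀ x, a₀ ≤ a' x)
    (hau : ∀ x, a' x ≤ A) (hq : ∀ x, |q' x| ≤ Q)
    (hclose : ∀ η > 0, ∃ X, ∀ x ≥ X, |a' x - a x| ≤ η ∧ |q' x - q x| ≤ η ∧ |c' x - c x| ≤ η)
    {p l : ℝ} (he : IsEffective a q c p l) :
    Tendsto (fun R : ℝ => lowerEigHalf (conjOp a' q' c' p) R) atTop (𝓝 (l : EReal)) ∧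
    Tendsto (fun R : ℝ => upperEigHalf (conjOp a' q' c' p) R) atTop (𝓝 (l : EReal)) := by
  have key : ∀ δ > 0, ∀ᶠ R in atTop,
      ((l - δ : ℝ) : EReal) ≤ lowerEigHalf (conjOp a' q' c' p) R ∧
      upperEigHalf (conjOp a' q' c' p) R ≤ ((l + δ : ℝ) : EReal) := by
    intro δ hδ
    obtain ⟨w, v, z, hp, hl⟩ := he (δ / 2) (half_pos hδ)
    obtain ⟨V, hV⟩ := hp.bdd_v
    obtain ⟨Z, hZ⟩ := hp.bdd_z
    have hV0 : 0 ≤ V := (abs_nonneg _).trans (hV 0)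
    have hZ0 : 0 ≤ Z := (abs_nonneg _).trans (hZ 0)
    set U := V + |p| with hU
    have hU0 : 0 ≤ U := by positivity
    -- The corrector for the limiting coefficients is kept as test function; this η limits the
    -- effect of changing coefficients on it to δ/2.
    set η := δ / 2 / (Z + U ^ 2 + U + 1) with hη
    have hη0 : 0 < η := by positivity
    obtain ⟨X, hX⟩ := hclose η hη0
    have hb : ∀ x ≥ X, |riccati a' q' c' p v z x - l| ≤ δ := by
      intro x hx
      obtain ⟨e1, e2, e3⟩ := hX x hx
      have hu : |v x + p| ≤ U := (abs_add_le _ _).trans (add_le_add_left (hV x) _)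
      have hu2 : |z x + (v x + p) ^ 2| ≤ Z + U ^ 2 := by
        refine (abs_add_le _ _).trans (add_le_add (hZ x) ?_)
        rw [abs_pow]
        exact pow_le_pow_left₀ (abs_nonneg _) hu 2
      have e : riccati a' q' c' p v z x - riccati a q c p v z x =
          (a' x - a x) * (z x + (v x + p) ^ 2) + (q' x - q x) * (v x + p) + (c' x - c x) := by
        simp only [riccati]; ring
      have k1 : |riccati a' q' c' p v z x - riccati a q c p v z x| ≤ δ / 2 := by
        rw [e]
        calc _ ≤ η * (Z + U ^ 2) + η * U + η := by
              refine (abs_add_le _ _).trans (add_le_add ((abs_add_le _ _).trans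
                (add_le_add ?_ ?_)) e3)
              · rw [abs_mul]; exact mul_le_mul e1 hu2 (abs_nonneg _) hη0.le
              · rw [abs_mul]; exact mul_le_mul e2 hu (abs_nonneg _) hη0.le
          _ = δ / 2 := by rw [hη]; field_simp
      have := abs_sub_le (riccati a' q' c' p v z x) (riccati a q c p v z x) l
      have := hl x
      linarith
    filter_upwards [eventually_ge_atTop X] with R hR
    exact ⟨hp.le_lowerEigHalf fun x hx => by
        have := abs_le.1 (hb x (hR.trans (le_of_lt hx))); linarith,
      hp.upperEigHalf_le fun x hx => by
        have := abs_le.1 (hb x (hR.trans (le_of_lt hx))); linarith⟩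
  -- The corrector bounds the lower eigenvalue only from below and the upper one only from above;
  -- the two missing bounds come from this inequality.
  have hmid := lowerEigHalf_le_upperEigHalf c' ha₀ hal hau hq p
  have hlow : ∀ b < (l : EReal), ∀ᶠ R in atTop, b < lowerEigHalf (conjOp a' q' c' p) R := by
    intro b hb
    obtain ⟨r, hr1, hr2⟩ := EReal.lt_iff_exists_real_btwn.1 hb
    have hr2' : r < l := by exact_mod_cast hr2
    filter_upwards [key (l - r) (by linarith)] with R hR
    rw [sub_sub_cancel] at hR
    exact hr1.trans_le hR.1
  have hupp : ∀ b > (l : EReal), ∀ᶠ R in atTop, upperEigHalf (conjOp a' q' c' p) R < b := by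
    intro b hb
    obtain ⟨r, hr1, hr2⟩ := EReal.lt_iff_exists_real_btwn.1 hb
    have hr1' : l < r := by exact_mod_cast hr1
    filter_upwards [key (r - l) (by linarith)] with R hR
    rw [add_sub_cancel] at hR
    exact hR.2.trans_lt hr2
  exact ⟨tendsto_order.2 ⟨hlow, fun b hb => (hupp b hb).mono fun R => (hmid R).trans_lt⟩,
    tendsto_order.2 ⟨fun b hb => (hlow b hb).mono fun R hR => hR.trans_le (hmid R), hupp⟩⟩

/-- A convex combination of correctors is a supersolution at the combined slope: its Riccati
expression is the combination of the two, minus s(1-s)a times the square of the slope difference. -/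
theorem convexOn_of_isEffective (h : EllipticCoeff a q c a₀ A Q C) {H : ℝ → ℝ}
    (hH : ∀ p, IsEffective a q c p (H p)) : ConvexOn ℝ univ H := by
  refine ⟨convex_univ, fun p _ p' _ s t hs ht hst => ?_⟩
  refine le_of_forall_pos_le_add fun δ hδ => ?_
  obtain ⟨w, v, z, hp, hl⟩ := hH p δ hδ
  obtain ⟨w', v', z', hp', hl'⟩ := hH p' δ hδ
  have hbd : ∀ f g : ℝ → ℝ, (∃ C, ∀ x, |f x| ≤ C) → (∃ C, ∀ x, |g x| ≤ C) →
      ∃ C, ∀ x, |s * f x + t * g x| ≤ C := by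
    rintro f g ⟨C, hC⟩ ⟨C', hC'⟩
    refine ⟨s * C + t * C', fun x => (abs_add_le _ _).trans ?_⟩
    rw [abs_mul, abs_mul, abs_of_nonneg hs, abs_of_nonneg ht]
    exact add_le_add (mul_le_mul_of_nonneg_left (hC x) hs) (mul_le_mul_of_nonneg_left (hC' x) ht)
  refine (hH _).le_of_profile h (w := fun x => s * w x + t * w' x)
    (v := fun x => s * v x + t * v' x) (z := fun x => s * z x + t * z' x)
    ⟨fun x => ((hp.deriv_w x).const_mul s).add ((hp'.deriv_w x).const_mul t),
      fun x => ((hp.deriv_v x).const_mul s).add ((hp'.deriv_v x).const_mul t),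
      (hp.cont_z.const_mul s).add (hp'.cont_z.const_mul t),
      hbd _ _ hp.bdd_w hp'.bdd_w, hbd _ _ hp.bdd_v hp'.bdd_v, hbd _ _ hp.bdd_z hp'.bdd_z⟩
    (fun x => ?_)
  have ha := h.pos.le.trans (h.le_a x)
  have k1 := (abs_le.1 (hl x)).2
  have k2 := (abs_le.1 (hl' x)).2
  obtain rfl : t = 1 - s := by linarith
  have e : riccati a q c (s • p + (1 - s) • p') (fun x => s * v x + (1 - s) * v' x)
      (fun x => s * z x + (1 - s) * z' x) x =
      s * riccati a q c p v z x + (1 - s) * riccati a q c p' v' z' x -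
        s * (1 - s) * (a x * ((v x + p) - (v' x + p')) ^ 2) := by
    simp only [riccati, smul_eq_mul]; ring
  have k3 : 0 ≤ s * (1 - s) * (a x * ((v x + p) - (v' x + p')) ^ 2) := by positivity
  have k4 : s * (riccati a q c p v z x - H p) ≤ s * δ := mul_le_mul_of_nonneg_left k1 hs
  have k5 : (1 - s) * (riccati a q c p' v' z' x - H p') ≤ (1 - s) * δ :=
    mul_le_mul_of_nonneg_left k2 ht
  rw [e, smul_eq_mul, smul_eq_mul]
  nlinarith

/-- The constant function φ = 1 is a test function, and its Riccati expression is the quadratic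
symbol. -/
lemma IsEffective.ge_of_quadratic (h : EllipticCoeff a q c a₀ A Q C) {p l m : ℝ}
    (he : IsEffective a q c p l) (hm : ∀ x, m ≤ a x * p ^ 2 + q x * p + c x) : m ≤ l := by
  refine he.ge_of_profile h (w := fun _ => 0) (v := fun _ => 0) (z := fun _ => 0)
    ⟨fun x => hasDerivAt_const _ _, fun x => hasDerivAt_const _ _, continuous_const,
      ⟨0, by simp⟩, ⟨0, by simp⟩, ⟨0, by simp⟩⟩ fun x => ?_
  simpa [riccati] using hm x

end Effective

/-! ### The linearised reaction term -/

section Reaction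

variable {a q : ℝ → ℝ} {f : ℝ → ℝ → ℝ}

lemma StandingAssumptions.exists_slope (hyp : StandingAssumptions a q f) (x : ℝ) {s : ℝ}
    (hs : s ∈ Ioc (0 : ℝ) 1) : ∃ ξ ∈ Ioo 0 s, derivWithin (f x) (Icc 0 1) ξ = f x s / s := by
  obtain ⟨ξ, hξ, e⟩ := exists_hasDerivAt_eq_slope (f x) (derivWithin (f x) (Icc 0 1)) hs.1
    ((hyp.f_diff x).continuousOn.mono (Icc_subset_Icc_right hs.2)) (fun t ht =>
      (((hyp.f_diff x) t ⟨ht.1.le, (ht.2.trans_le hs.2).le⟩).hasDerivWithinAt).hasDerivAt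
        (Icc_mem_nhds ht.1 (ht.2.trans_le hs.2)))
  exact ⟨ξ, hξ, by rw [e, hyp.f_zero, sub_zero, sub_zero]⟩

/-- By the mean value theorem and the Hölder bound, difference quotients at 0 converge uniformly in
x. The linearised coefficient thereby inherits the uniform continuity of f(·, s). -/
lemma StandingAssumptions.abs_dsZero_sub_le (hyp : StandingAssumptions a q f) :
    ∃ γ : ℝ, 0 < γ ∧ ∃ C : ℝ, 0 ≤ C ∧ ∀ x, ∀ s ∈ Ioc (0 : ℝ) 1, |dsZero f x - f x s / s| ≤ C * s ^ γ := by
  obtain ⟨γ, hγ, C, hC⟩ := hyp.f_holder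
  refine ⟨γ, hγ.1, |C|, abs_nonneg C, fun x s hs => ?_⟩
  obtain ⟨ξ, hξ, e⟩ := hyp.exists_slope x hs
  rw [← e]
  refine (hC x 0 ⟨le_rfl, zero_le_one⟩ ξ ⟨hξ.1.le, (hξ.2.trans_le hs.2).le⟩).trans ?_
  rw [zero_sub, abs_neg, abs_of_pos hξ.1]
  have h1 : ξ ^ γ ≤ s ^ γ := Real.rpow_le_rpow hξ.1.le hξ.2.le hγ.1.le
  have h2 : 0 ≤ ξ ^ γ := Real.rpow_nonneg hξ.1.le γ
  exact mul_le_mul (le_abs_self C) h1 h2 (abs_nonneg C)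

lemma StandingAssumptions.dsZero_bounded (hyp : StandingAssumptions a q f) :
    ∃ C, ∀ x, |dsZero f x| ≤ C := by
  obtain ⟨γ, -, C, -, hC⟩ := hyp.abs_dsZero_sub_le
  refine ⟨C, fun x => ?_⟩
  -- At s = 1 the quotient vanishes because f(x, 1) = 0.
  simpa [hyp.f_one] using hC x 1 ⟨one_pos, le_rfl⟩

lemma StandingAssumptions.dsZero_uniformContinuous (hyp : StandingAssumptions a q f) :
    UniformContinuous (dsZero f) := by
  obtain ⟨γ, hγ, C, hC0, hC⟩ := hyp.abs_dsZero_sub_le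
  rw [Metric.uniformContinuous_iff]
  intro ε hε
  obtain ⟨s, hs, hsε⟩ : ∃ s ∈ Ioc (0 : ℝ) 1, C * s ^ γ < ε / 3 := by
    have h1 : Tendsto (fun s : ℝ => C * s ^ γ) (𝓝[>] 0) (𝓝 (C * 0 ^ γ)) :=
      (((Real.continuous_rpow_const hγ.le).tendsto 0).mono_left nhdsWithin_le_nhds).const_mul C
    rw [Real.zero_rpow hγ.ne', mul_zero] at h1
    obtain ⟨s, h2, h3⟩ := ((h1.eventually (gt_mem_nhds (by positivity : 0 < ε / 3))).and
      (Ioc_mem_nhdsGT (zero_lt_one' ℝ))).exists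
    exact ⟨s, h3, h2⟩
  have hs0 := hs.1
  obtain ⟨δ, hδ, hδ'⟩ := hyp.f_unifCont (s * (ε / 3)) (by positivity)
  refine ⟨δ, hδ, fun {x y} hxy => ?_⟩
  have h1 := (abs_le.1 (hC x s hs))
  have h2 := (abs_le.1 (hC y s hs))
  have h3 : |f x s / s - f y s / s| < ε / 3 := by
    rw [← sub_div, abs_div, abs_of_pos hs.1, div_lt_iff₀ hs.1, mul_comm]
    exact hδ' s ⟨hs.1.le, hs.2⟩ x y (by rwa [Real.dist_eq] at hxy)
  have h4 := abs_lt.1 h3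
  rw [Real.dist_eq, abs_lt]
  constructor <;> linarith

/-- The liminf is a real `sSup` of eventual lower bounds. If none that holds near +∞ is positive,
that `sSup` is at most 0, also in the degenerate cases where it takes the default value 0. -/
lemma StandingAssumptions.exists_discriminant_bound (hyp : StandingAssumptions a q f) :
    ∃ β > 0, ∃ X, ∀ x ≥ X, β ≤ 4 * dsZero f x * a x - q x ^ 2 := by
  by_contra! hcon
  have h0 : liminf (fun x => 4 * dsZero f x * a x - q x ^ 2) (cocompact ℝ) ≤ 0 := by
    rw [liminf_eq]
    refine Real.sSup_nonpos fun β hβ => ?_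
    by_contra! hpos
    obtain ⟨X, hX⟩ := eventually_atTop.1 (Eventually.filter_mono atTop_le_cocompact hβ)
    obtain ⟨x, hx, hlt⟩ := hcon β hpos X
    exact absurd (hX x hx) (not_le.2 hlt)
  exact absurd hyp.liminf_pos (not_lt.2 h0)

end Reaction

/-! ### Properties inherited by the almost periodic limits -/

section Limit

variable {a q c aS qS cS : ℝ → ℝ}

/-- For a large almost period t one has aS(x) ≈ aS(x+t) ≈ a(x+t). Thus closed conditions satisfied
by the original coefficients near +∞ pass to the limiting ones everywhere. -/
lemma exists_translate (haS : AlmostPeriodic aS) (hqS : AlmostPeriodic qS)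
    (hcS : AlmostPeriodic cS)
    (hclose : ∀ η > 0, ∃ X, ∀ x ≥ X, |a x - aS x| ≤ η ∧ |q x - qS x| ≤ η ∧ |c x - cS x| ≤ η)
    {η : ℝ} (hη : 0 < η) (X y : ℝ) : ∃ t, X ≤ y + t ∧ ∀ x ≥ y,
      |a (x + t) - aS x| ≤ η ∧ |q (x + t) - qS x| ≤ η ∧ |c (x + t) - cS x| ≤ η := by
  obtain ⟨X', hX'⟩ := hclose (η / 2) (half_pos hη)
  obtain ⟨t, ht, hp⟩ := haS.exists_large_almostPeriod hqS hcS (half_pos hη) (max X X' - y)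
  have h1 := le_max_left X X'
  have h2 := le_max_right X X'
  refine ⟨t, by linarith, fun x hx => ?_⟩
  obtain ⟨a1, a2, a3⟩ := hX' (x + t) (by linarith)
  obtain ⟨b1, b2, b3⟩ := hp x
  have aux : ∀ r s u : ℝ, |r - s| ≤ η / 2 → |s - u| ≤ η / 2 → |r - u| ≤ η := fun r s u h h' =>
    (abs_sub_le r s u).trans (by linarith)
  exact ⟨aux _ _ _ a1 b1, aux _ _ _ a2 b2, aux _ _ _ a3 b3⟩

/-- `AlmostPeriodic` does not include continuity, so it is recovered from the approximating
translates of g. -/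
lemma continuous_of_translate {g gS : ℝ → ℝ} (hg : UniformContinuous g)
    (h : ∀ η > 0, ∀ y, ∃ t, ∀ x ≥ y, |g (x + t) - gS x| ≤ η) : Continuous gS := by
  rw [Metric.continuous_iff]
  intro x ε hε
  obtain ⟨δ, hδ, hgδ⟩ := Metric.uniformContinuous_iff.1 hg (ε / 3) (by positivity)
  obtain ⟨t, ht⟩ := h (ε / 3) (by positivity) (x - 1)
  refine ⟨min δ 1, by positivity, fun y hy => ?_⟩
  rw [lt_min_iff] at hy
  have h1 := hgδ (a := y + t) (b := x + t) (by simpa [Real.dist_eq] using hy.1)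
  have h2 := hy.2
  rw [Real.dist_eq, abs_lt] at h1 h2
  have h3 := abs_le.1 (ht x (by linarith))
  have h4 := abs_le.1 (ht y (by linarith))
  rw [Real.dist_eq, abs_lt]
  constructor <;> linarith

end Limit

/-! ### Minimality of the speed -/

/-- H(-p)/p is at least κ/p near 0 and at least a₀p - Q - C/p for large p. With s and t below, it is
at least its value N at p = 1 outside [s, t]; this interval contains 1, so the minimum over it is
global. -/
lemma exists_min_speed {H : ℝ → ℝ} (hH : Continuous H) {κ a₀ Q C : ℝ} (hκ : 0 < κ)
    (ha₀ : 0 < a₀) (hQ : 0 ≤ Q) (hC : 0 ≤ C) (h₁ : ∀ p, κ ≤ H p)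
    (h₂ : ∀ p, a₀ * p ^ 2 - Q * |p| - C ≤ H p) :
    ∃ p₀ > 0, ∀ p > 0, H (-p₀) / p₀ ≤ H (-p) / p := by
  set N := H (-1) with hN
  have hκN : κ ≤ N := h₁ _
  have hN0 : 0 < N := hκ.trans_le hκN
  set s := κ / N with hs
  have hs0 : 0 < s := by positivity
  have hs1 : s ≤ 1 := (div_le_one hN0).2 hκN
  set t := 1 + (N + Q + C) / a₀ with ht
  have ht1 : 1 ≤ t := by
    have : 0 ≤ (N + Q + C) / a₀ := by positivity
    linarith
  have hcont : ContinuousOn (fun p => H (-p) / p) (Icc s t) :=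
    (hH.comp continuous_neg).continuousOn.div continuousOn_id
      fun p hp => (hs0.trans_le hp.1).ne'
  obtain ⟨p₀, hp₀, hmin⟩ := isCompact_Icc.exists_isMinOn ⟨1, hs1, ht1⟩ hcont
  refine ⟨p₀, hs0.trans_le hp₀.1, fun p hp => ?_⟩
  have h1 : H (-p₀) / p₀ ≤ N := by simpa using hmin (⟨hs1, ht1⟩ : (1 : ℝ) ∈ Icc s t)
  rcases lt_or_ge p s with h | h
  · refine h1.trans ?_
    rw [le_div_iff₀ hp]
    rw [hs, lt_div_iff₀ hN0] at h
    linarith [h₁ (-p)]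
  rcases le_or_gt p t with h' | h'
  · exact hmin ⟨h, h'⟩
  · refine h1.trans ?_
    rw [le_div_iff₀ hp]
    refine le_trans ?_ (h₂ (-p))
    rw [abs_neg, abs_of_pos hp, neg_sq]
    have k1 : N + Q + C ≤ a₀ * p := by
      have : (N + Q + C) / a₀ ≤ p := by linarith
      rwa [div_le_iff₀ ha₀, mul_comm] at this
    have k2 : 1 ≤ p := ht1.trans h'.le
    nlinarith

lemma isLeast_speedValues {K : ℝ → EReal} {H : ℝ → ℝ} (hK : ∀ p, K p = H p) {p₀ : ℝ}
    (hp₀ : 0 < p₀) (hmin : ∀ p > 0, H (-p₀) / p₀ ≤ H (-p) / p) :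
    IsLeast (speedValues K) ((H (-p₀) / p₀ : ℝ) : EReal) := by
  have he : ∀ p : ℝ, K (-p) / (p : EReal) = ((H (-p) / p : ℝ) : EReal) := fun p => by
    rw [hK, EReal.coe_div]
  refine ⟨⟨p₀, hp₀, he p₀⟩, ?_⟩
  rintro _ ⟨p, hp, rfl⟩
  change _ ≤ K (-p) / (p : EReal)
  rw [he, EReal.coe_le_coe_iff]
  exact hmin p hp

end MonostableKPP

theorem proposition2p8 (a q : ℝ → ℝ) (f : ℝ → ℝ → ℝ) (hyp : StandingAssumptions a q f)
    (aS qS cS : ℝ → ℝ)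
    (haS : AlmostPeriodic aS) (hqS : AlmostPeriodic qS) (hcS : AlmostPeriodic cS)
    (hconv : Tendsto
      (fun R : ℝ => ⨆ x ∈ Ici R,
        ((|a x - aS x| + |q x - qS x| + |dsZero f x - cS x| : ℝ) : EReal))
      atTop (𝓝 0)) :
    -- both limits as R → +∞ exist and equal both eigenvalues of `L*_p`, a finite number
    (∀ p : ℝ, ∃ l : ℝ,
      Tendsto (fun R : ℝ => lowerEigHalf (conjOp a q (dsZero f) p) R) atTop (𝓝 (l : EReal)) ∧
      Tendsto (fun R : ℝ => upperEigHalf (conjOp a q (dsZero f) p) R) atTop (𝓝 (l : EReal)) ∧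
      lowerH a q (dsZero f) p = (l : EReal) ∧
      upperH a q (dsZero f) p = (l : EReal) ∧
      upperEigLine (conjOp aS qS cS p) = (l : EReal) ∧
      lowerEigLine (conjOp aS qS cS p) = (l : EReal)) ∧
    -- all the speeds are equal, finite, and the infima over p > 0 are minima
    (∃ w : ℝ,
      upperSpeed a q (dsZero f) = (w : EReal) ∧
      lowerSpeed a q (dsZero f) = (w : EReal) ∧
      IsLeast (speedValues (upperH a q (dsZero f))) (w : EReal) ∧
      IsLeast (speedValues (lowerH a q (dsZero f))) (w : EReal) ∧
      IsLeast (speedValues (fun p => upperEigLine (conjOp aS qS cS p))) (w : EReal) ∧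
      IsLeast (speedValues (fun p => lowerEigLine (conjOp aS qS cS p))) (w : EReal)) := by
  obtain ⟨A, hA⟩ := hyp.a_bounded
  obtain ⟨Q, hQ⟩ := hyp.q_bounded
  obtain ⟨C, hC⟩ := hyp.dsZero_bounded
  obtain ⟨β, hβ, X₀, hX₀⟩ := hyp.exists_discriminant_bound
  have ha₀ := hyp.a_pos
  set a₀ := ⨅ x, a x with ha₀_def
  have hal : ∀ x, a₀ ≤ a x := fun x =>
    ciInf_le ⟨-A, by rintro _ ⟨y, rfl⟩; exact (abs_le.1 (hA y)).1⟩ x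
  have hau : ∀ x, a x ≤ A := fun x => (abs_le.1 (hA x)).2
  have hA0 : 0 < A := ha₀.trans_le ((hal 0).trans (hau 0))
  have hQ0 : 0 ≤ Q := (abs_nonneg _).trans (hQ 0)
  have hC0 : 0 ≤ C := (abs_nonneg _).trans (hC 0)
  have hclose : ∀ η > 0, ∃ X, ∀ x ≥ X,
      |a x - aS x| ≤ η ∧ |q x - qS x| ≤ η ∧ |dsZero f x - cS x| ≤ η := by
    intro η hη
    obtain ⟨X, hX⟩ := (hconv.eventually (gt_mem_nhds
      (by exact_mod_cast hη : (0 : EReal) < (η : EReal)))).exists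
    refine ⟨X, fun x hx => ?_⟩
    have h1 := (le_iSup₂ (f := fun x (_ : x ∈ Ici X) =>
      ((|a x - aS x| + |q x - qS x| + |dsZero f x - cS x| : ℝ) : EReal)) x hx).trans_lt hX
    have h2 : |a x - aS x| + |q x - qS x| + |dsZero f x - cS x| < η := by exact_mod_cast h1
    have := abs_nonneg (a x - aS x)
    have := abs_nonneg (q x - qS x)
    have := abs_nonneg (dsZero f x - cS x)
    exact ⟨by linarith, by linarith, by linarith⟩
  have htr := fun (η : ℝ) (hη : η > 0) => exists_translate haS hqS hcS hclose hη
  have hpt : ∀ x, ∀ η > 0, ∃ y ≥ X₀,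
      |a y - aS x| ≤ η ∧ |q y - qS x| ≤ η ∧ |dsZero f y - cS x| ≤ η := fun x η hη => by
    obtain ⟨t, ht, h⟩ := htr η hη X₀ x
    exact ⟨x + t, ht, h x le_rfl⟩
  have hE : EllipticCoeff aS qS cS a₀ A Q C := by
    refine ⟨continuous_of_translate hyp.a_unifCont fun η hη y => ?_,
      continuous_of_translate hyp.q_unifCont fun η hη y => ?_,
      continuous_of_translate hyp.dsZero_uniformContinuous fun η hη y => ?_, ha₀,
      fun x => le_of_forall_pos_le_add fun η hη => ?_,
      fun x => le_of_forall_pos_le_add fun η hη => ?_,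
      fun x => le_of_forall_pos_le_add fun η hη => ?_,
      fun x => le_of_forall_pos_le_add fun η hη => ?_⟩
    · obtain ⟨t, -, h⟩ := htr η hη X₀ y
      exact ⟨t, fun x hx => (h x hx).1⟩
    · obtain ⟨t, -, h⟩ := htr η hη X₀ y
      exact ⟨t, fun x hx => (h x hx).2.1⟩
    · obtain ⟨t, -, h⟩ := htr η hη X₀ y
      exact ⟨t, fun x hx => (h x hx).2.2⟩
    · obtain ⟨y, -, h, -, -⟩ := hpt x η hη
      linarith [hal y, (abs_le.1 h).2]
    · obtain ⟨y, -, h, -, -⟩ := hpt x η hη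
      linarith [hau y, (abs_le.1 h).1]
    · obtain ⟨y, -, -, h, -⟩ := hpt x η hη
      have h1 := abs_le.1 h
      have h2 := abs_le.1 (hQ y)
      rw [abs_le]
      constructor <;> linarith
    · obtain ⟨y, -, -, -, h⟩ := hpt x η hη
      have h1 := abs_le.1 h
      have h2 := abs_le.1 (hC y)
      rw [abs_le]
      constructor <;> linarith
  -- Completing the square, 4a(ap² + qp + c) = (2ap + q)² + 4ac - q² ≥ β far to the right; since a ≤
  -- A the symbol is at least β/(4A) there, and translation carries this bound to the limit.
  have hquad : ∀ x p, β / (4 * A) ≤ aS x * p ^ 2 + qS x * p + cS x := by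
    intro x p
    refine le_of_forall_pos_le_add fun δ hδ => ?_
    have hD : 0 < p ^ 2 + |p| + 1 := by positivity
    obtain ⟨y, hy, h1, h2, h3⟩ := hpt x (δ / (p ^ 2 + |p| + 1)) (by positivity)
    set η := δ / (p ^ 2 + |p| + 1) with hη
    have e : η * p ^ 2 + η * |p| + η = δ := by rw [hη]; field_simp
    have k1 : (a y - aS x) * p ^ 2 ≤ η * p ^ 2 :=
      mul_le_mul_of_nonneg_right (abs_le.1 h1).2 (sq_nonneg p)
    have k2 : (q y - qS x) * p ≤ η * |p| := by
      refine (le_abs_self _).trans ?_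
      rw [abs_mul]
      exact mul_le_mul_of_nonneg_right h2 (abs_nonneg p)
    have k3 := (abs_le.1 h3).2
    have k4 := hX₀ y hy
    have hay : 0 < a y := ha₀.trans_le (hal y)
    have k5 : β ≤ 4 * a y * (a y * p ^ 2 + q y * p + dsZero f y) := by
      nlinarith [sq_nonneg (2 * a y * p + q y)]
    have k6 : 0 < a y * p ^ 2 + q y * p + dsZero f y := by
      by_contra! hn
      nlinarith
    have k7 : β / (4 * A) ≤ a y * p ^ 2 + q y * p + dsZero f y := by
      rw [div_le_iff₀ (by positivity)]
      have := mul_le_mul_of_nonneg_right (hau y) k6.le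
      linarith
    linarith
  choose H hH using fun p => exists_isEffective hE haS hqS hcS p
  have hlim := fun p => (hH p).tendsto_eigHalf ha₀ hal hau hQ hclose
  have hline := fun p => (hH p).eigLine_eq hE
  have hlow : ∀ p, lowerH a q (dsZero f) p = (H p : EReal) := fun p => (hlim p).1.limUnder_eq
  have hupp : ∀ p, upperH a q (dsZero f) p = (H p : EReal) := fun p => (hlim p).2.limUnder_eq
  refine ⟨fun p => ⟨H p, (hlim p).1, (hlim p).2, hlow p, hupp p, (hline p).1, (hline p).2⟩, ?_⟩
  -- Convexity is needed only here, for the continuity of H.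
  have hHc : Continuous H := continuousOn_univ.1
    ((convexOn_of_isEffective hE hH).continuousOn isOpen_univ)
  obtain ⟨p₀, hp₀, hmin⟩ := exists_min_speed hHc (by positivity : 0 < β / (4 * A)) ha₀ hQ0 hC0
    (fun p => (hH p).ge_of_quadratic hE fun x => hquad x p)
    (fun p => (hH p).ge_of_quadratic hE fun x => by
      have k1 := mul_le_mul_of_nonneg_right (hE.le_a x) (sq_nonneg p)
      have k2 := (abs_le.1 (hE.abs_c_le x)).1
      have k3 : |qS x * p| ≤ Q * |p| := by
        rw [abs_mul]
        exact mul_le_mul_of_nonneg_right (hE.abs_q_le x) (abs_nonneg p)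
      have k4 := (abs_le.1 k3).1
      linarith)
  have l1 := isLeast_speedValues hupp hp₀ hmin
  have l2 := isLeast_speedValues hlow hp₀ hmin
  exact ⟨H (-p₀) / p₀, l1.isGLB.sInf_eq, l2.isGLB.sInf_eq, l1, l2,
    isLeast_speedValues (fun p => (hline p).1) hp₀ hmin,
    isLeast_speedValues (fun p => (hline p).2) hp₀ hmin⟩
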